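/- Let $\Omega=\,]-1,1[$ and, for $f\in L^1(\Omega)$, $f\ge 0$, consider the problem $$-\Big(\frac{u'}{|u'|}\Big)'=\frac fu\ \text{ in }\,]-1,1[,\qquad u(-1)=0=u(1). \tag{P}$$ A *weak solution* is a function $u\in BV(\Omega)\cap L^\infty(\Omega)$, $u\ge0$ a.e., for which there is a field $z\in L^\infty(\Omega)$ with $\|z\|_\infty\le1$, whose distributional derivative $z'$ is a Radon measure in $\Omega$ (locally of finite total variation), such that (a) $f/u\in L^1_{\rm loc}(\Omega)$, where $f/u:=0$ on $\{f=0\}$ and $f/u:=+\infty$ on $\{u=0<f\}$; (b) $\chi_{\{u>0\}}\in BV_{\rm loc}(\Omega)$; (c) $-z'\,\chi^*_{\{u>0\}}=f/u$ in $\mathcal D'(\Omega)$; (d) $(z,Du)=|Du|$ and $(z,D\chi_{\{u>0\}})=|D\chi_{\{u>0\}}|$ as measures in $\Omega$; (e) $uz$ has a derivative of finite total variation, and $u+[uz,\nu]=0$ at $x=\pm1$. Here $v^*$ is the precise representative of $v$ (the mean of the one-sided limits at jump points), $\langle (z,Dv),\varphi\rangle=-\int_\Omega v^*\varphi\,dz'-\int_\Omega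 v z\varphi'\,dx$ for $\varphi\in C_c^\infty(\Omega)$, in (e) $u$ stands for its boundary trace, and the normal trace $[w,\nu]$ is given by the Green formula $\int_\Omega\psi\,dw'+\int_\Omega w\psi'\,dx=[w,\nu](1)\psi(1)+[w,\nu](-1)\psi(-1)$ for all smooth $\psi$. We say that $u$ is a solution *with* $z$. **Example 1.** Let $f=\chi_{]-1/2,1/2[}$, and let $z_1=1$ on $]-1,-\frac12[$, $z_1(x)=-2x$ on $[-\frac12,\frac12]$, $z_1=-1$ on $]\frac12,1[$. Then $u_1=\frac12$ is a weak solution of (P) with $z_1$. More generally, every $u:\,]-1,1[\,\to[0,\frac12]$ that is nondecreasing on $]-1,-\frac12]$, equal to $\frac12$ on $]-\frac12,\frac12[$ and nonincreasing on $[\frac12,1[$ is a weak solution with $z_1$; in particular $u_2=\frac12\chi_{]-1/2,1/2[}$ is. Moreover $u_2$ is also a weak solution with the different field $z_2(x)=2(x+1)$ on $]-1,-\frac12[$, $z_2(x)=-2x$ on $[-\frac12,\frac12]$, $z_2(x)=2(x-1)$ on $]\frac12,1[$. One has $z_1'=z_1'\chi^*_{\{u_2>0\}}$ but $z_2'\ne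 z_2'\chi^*_{\{u_2>0\}}$. **Example 2.** Let $f(x)=x-\frac12$ on $[\frac12,1[$, $f=0$ on $]-\frac12,\frac12[$, $f(x)=-x-\frac12$ on $]-1,-\frac12]$. Then the following are weak solutions of (P), no two of which are a.e. equal: * $u_1=\frac18$, with $z_1(x)=-4x^2+4x-1$ on $[\frac12,1[$, $z_1=0$ on $]-\frac12,\frac12[$, $z_1(x)=4x^2+4x+1$ on $]-1,-\frac12]$; * $u_2=\frac1{16}\chi_{\{f>0\}}$, with $z_2(x)=-8x^2+8x-1$ on $[\frac12,1[$, $z_2(x)=2x$ on $]-\frac12,\frac12[$, $z_2(x)=8x^2+8x+1$ on $]-1,-\frac12]$; * $u_3=\frac1{16}\chi_{]-1,-1/4[\,\cup\,]1/4,1[}$, with $z_3(x)=-8x^2+8x-1$ on $[\frac12,1[$, $z_3=1$ on $[\frac14,\frac12[$, $z_3(x)=4x$ on $]-\frac14,\frac14[$, $z_3=-1$ on $]-\frac12,-\frac14]$, $z_3(x)=8x^2+8x+1$ on $]-1,-\frac12]$. Moreover $u_1\ne u_2$ at every point of $\{f>0\}$, and $z_2'\chi^*_{\{u_2>0\}}\ne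 z_2'$. In both examples $f\in L^1(\Omega)$, $f\ge0$, $f$ vanishes on a set of positive measure, and (P) has weak solutions that are not a.e. equal; so uniqueness fails. -/

import Mathlib

open Set Filter Topology MeasureTheory
open scoped ENNReal ContDiff

noncomputable section

namespace OneLap

/-- A (signed) Radon measure on the open set `Ω ⊆ ℝ`, possibly of infinite total variation, given
by its Jordan decomposition: two mutually singular positive measures, concentrated on `Ω` and
finite on the compact subsets of `Ω`. -/
structure RadonMeasure (Ω : Set ℝ) where
  pos : Measure ℝ
  neg : Measure ℝ
  pos_conc : pos Ωᶜ = 0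
  neg_conc : neg Ωᶜ = 0
  pos_lt_top : ∀ K : Set ℝ, IsCompact K → K ⊆ Ω → pos K < ⊤
  neg_lt_top : ∀ K : Set ℝ, IsCompact K → K ⊆ Ω → neg K < ⊤
  sing : pos ⟂ₘ neg

namespace RadonMeasure

variable {Ω : Set ℝ}

/-- The total variation measure `|μ|`. -/
def var (μ : RadonMeasure Ω) : Measure ℝ := μ.pos + μ.neg

/-- The integral `∫ g dμ`. -/
def integral (μ : RadonMeasure Ω) (g : ℝ → ℝ) : ℝ := (∫ x, g x ∂μ.pos) - ∫ x, g x ∂μ.neg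

/-- `μ` has finite total variation. -/
def Finite (μ : RadonMeasure Ω) : Prop := μ.var Ω < ⊤

end RadonMeasure

/-- Test functions: `φ ∈ C_c^∞(Ω)`. -/
structure IsTest (Ω : Set ℝ) (φ : ℝ → ℝ) : Prop where
  smooth : ContDiff ℝ ∞ φ
  compact : HasCompactSupport φ
  supp : tsupport φ ⊆ Ω

/-- The distributional derivative of `v` on `Ω` is the Radon measure `μ`. In dimension one this is
at once the gradient `Dv` of a scalar function and the divergence of a vector field. -/
def HasDeriv (Ω : Set ℝ) (v : ℝ → ℝ) (μ : RadonMeasure Ω) : Prop :=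
  ∀ φ, IsTest Ω φ → ∫ x in Ω, v x * deriv φ x = -μ.integral φ

/-- `v ∈ BV_loc(Ω)` with `Dv = μ`. -/
def IsBVLoc (Ω : Set ℝ) (v : ℝ → ℝ) (μ : RadonMeasure Ω) : Prop :=
  LocallyIntegrableOn v Ω volume ∧ HasDeriv Ω v μ

/-- `v ∈ BV(Ω)` with `Dv = μ`. -/
def IsBV (Ω : Set ℝ) (v : ℝ → ℝ) (μ : RadonMeasure Ω) : Prop :=
  IntegrableOn v Ω volume ∧ HasDeriv Ω v μ ∧ μ.Finite

/-- `z ∈ L^∞(Ω)` and its divergence is the Radon measure `μ` (which need not be finite). -/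
def IsDMLoc (Ω : Set ℝ) (z : ℝ → ℝ) (μ : RadonMeasure Ω) : Prop :=
  MemLp z ⊤ (volume.restrict Ω) ∧ HasDeriv Ω z μ

/-- `z ∈ L^∞(Ω)` and its divergence is the Radon measure `μ` of finite total variation. -/
def IsDM (Ω : Set ℝ) (z : ℝ → ℝ) (μ : RadonMeasure Ω) : Prop :=
  IsDMLoc Ω z μ ∧ μ.Finite

/-- `x` is a Lebesgue point of `v` with value `c`. -/
def ApproxLim (v : ℝ → ℝ) (x c : ℝ) : Prop :=
  Tendsto (fun ρ : ℝ => (2 * ρ)⁻¹ * ∫ y in Ioo (x - ρ) (x + ρ), |v y - c|) (𝓝[>] 0) (𝓝 0)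

/-- `c` is the approximate limit of `v` at `x` from the right. -/
def ApproxLimRight (v : ℝ → ℝ) (x c : ℝ) : Prop :=
  Tendsto (fun ρ : ℝ => ρ⁻¹ * ∫ y in Ioo x (x + ρ), |v y - c|) (𝓝[>] 0) (𝓝 0)

/-- `c` is the approximate limit of `v` at `x` from the left. -/
def ApproxLimLeft (v : ℝ → ℝ) (x c : ℝ) : Prop :=
  Tendsto (fun ρ : ℝ => ρ⁻¹ * ∫ y in Ioo (x - ρ) x, |v y - c|) (𝓝[>] 0) (𝓝 0)

/-- `c` is the value at `x` of the precise representative of `v`: the Lebesgue value at a Lebesgue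
point, and the mean of the two one-sided approximate limits at an approximate jump point. -/
def PreciseValue (v : ℝ → ℝ) (x c : ℝ) : Prop :=
  ApproxLim v x c ∨
    ∃ p q : ℝ, p ≠ q ∧ ApproxLimLeft v x p ∧ ApproxLimRight v x q ∧ c = (p + q) / 2

/-- `w = v*` on `Ω`. For a function of locally bounded variation on an open set of the line, every
point is either a Lebesgue point or an approximate jump point. -/
def IsPreciseRep (Ω : Set ℝ) (v w : ℝ → ℝ) : Prop :=
  ∀ x ∈ Ω, PreciseValue v x (w x)

/-- The value at `φ` of the pairing
`⟨(z, Dv), φ⟩ = - ∫ v* φ d(div z) - ∫ v z φ' dx`, with `μ = div z` and `w = v*`. -/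
def pairing (Ω : Set ℝ) (z : ℝ → ℝ) (μ : RadonMeasure Ω) (v w φ : ℝ → ℝ) : ℝ :=
  -μ.integral (fun x => w x * φ x) - ∫ x in Ω, v x * z x * deriv φ x

/-- `(z, Dv) = |Dv|` as measures in `Ω`, where `μ = div z` and `κ = Dv`, together with the local
`div z`-integrability of the precise representative `v*` that the pairing presupposes. -/
def PairingEqVar (Ω : Set ℝ) (z : ℝ → ℝ) (μ : RadonMeasure Ω) (v : ℝ → ℝ)
    (κ : RadonMeasure Ω) : Prop :=
  ∃ w : ℝ → ℝ, IsPreciseRep Ω v w ∧ LocallyIntegrableOn w Ω μ.var ∧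
    ∀ φ, IsTest Ω φ → pairing Ω z μ v w φ = ∫ x, φ x ∂κ.var

/-- The field `w` belongs to `DM^∞(]a,b[)` and its weak normal traces `[w, ν]` at the boundary
points `a` and `b` are `na` and `nb`: these are the numbers in the Green formula
`∫ ψ d(div w) + ∫ w ψ' dx = nb ψ(b) + na ψ(a)` for all smooth `ψ`. -/
def HasNormalTrace (a b : ℝ) (w : ℝ → ℝ) (na nb : ℝ) : Prop :=
  ∃ μ : RadonMeasure (Ioo a b), IsDM (Ioo a b) w μ ∧
    ∀ ψ : ℝ → ℝ, ContDiff ℝ ∞ ψ →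
      μ.integral ψ + ∫ x in Ioo a b, w x * deriv ψ x = nb * ψ b + na * ψ a

/-- `χ_{u>0}`. -/
def posInd (u : ℝ → ℝ) : ℝ → ℝ := indicator {x | 0 < u x} 1

/-- The singular term `f / u^γ`, with values in `[0,∞]`. In `ℝ≥0∞` one has `0 / 0 = 0` and
`c / 0 = ∞` for `c > 0`, so it is `0` where `f = 0` and `∞` where `u = 0 < f`. -/
def singTerm (γ : ℝ) (f u : ℝ → ℝ) (x : ℝ) : ℝ≥0∞ :=
  ENNReal.ofReal (f x) / ENNReal.ofReal (u x ^ γ)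

/-- Admissible data: `f ∈ L^1(]a,b[)`, `f ≥ 0` a.e. -/
def IsDatum (a b : ℝ) (f : ℝ → ℝ) : Prop :=
  IntegrableOn f (Ioo a b) volume ∧ ∀ᵐ x ∂volume.restrict (Ioo a b), 0 ≤ f x

/-- `u` is a weak solution of `-(u'/|u'|)' = f/u^γ` in `]a,b[`, `u(a) = 0 = u(b)`, and `z` is a
vector field that plays the role of `u'/|u'|`. Only the values on `]a,b[` matter. -/
def IsWeakSolutionWith (a b γ : ℝ) (f u z : ℝ → ℝ) : Prop :=
  -- `u ∈ BV ∩ L^∞`, `u ≥ 0`, `z ∈ DM_loc`, `‖z‖_∞ ≤ 1`, `χ_{u>0} ∈ BV_loc`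
  MemLp u ⊤ (volume.restrict (Ioo a b)) ∧
  (∀ᵐ x ∂volume.restrict (Ioo a b), 0 ≤ u x) ∧
  eLpNorm z ⊤ (volume.restrict (Ioo a b)) ≤ 1 ∧
  ∃ (Du Dχ divz : RadonMeasure (Ioo a b)),
    IsBV (Ioo a b) u Du ∧ IsBVLoc (Ioo a b) (posInd u) Dχ ∧ IsDMLoc (Ioo a b) z divz ∧
    -- `f / u^γ ∈ L^1_loc`
    (∀ K : Set ℝ, IsCompact K → K ⊆ Ioo a b → ∫⁻ x in K, singTerm γ f u x < ⊤) ∧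
    -- `-(div z) χ*_{u>0} = f / u^γ` in the sense of distributions
    (∃ w : ℝ → ℝ, IsPreciseRep (Ioo a b) (posInd u) w ∧
      LocallyIntegrableOn w (Ioo a b) divz.var ∧
      ∀ φ, IsTest (Ioo a b) φ →
        -divz.integral (fun x => w x * φ x)
          = ∫ x in Ioo a b, (singTerm γ f u x).toReal * φ x) ∧
    -- `(z, Du) = |Du|` and `(z, Dχ_{u>0}) = |Dχ_{u>0}|`
    PairingEqVar (Ioo a b) z divz u Du ∧
    PairingEqVar (Ioo a b) z divz (posInd u) Dχ ∧
    -- `u + [u z, ν] = 0` at both boundary points, `ua` and `ub` being the traces of `u`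
    ∃ ua ub na nb : ℝ, ApproxLimRight u a ua ∧ ApproxLimLeft u b ub ∧
      HasNormalTrace a b (fun x => u x * z x) na nb ∧ ua + na = 0 ∧ ub + nb = 0

/-- `u` is a weak solution of `-(u'/|u'|)' = f/u^γ` in `]a,b[`, `u(a) = 0 = u(b)`. -/
def IsWeakSolution (a b γ : ℝ) (f u : ℝ → ℝ) : Prop :=
  ∃ z : ℝ → ℝ, IsWeakSolutionWith a b γ f u z

/-- `z' = z' χ*_{u>0}` as Radon measures in `Ω`. -/
def DerivCarried (Ω : Set ℝ) (z u : ℝ → ℝ) : Prop :=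
  ∃ (μ : RadonMeasure Ω) (w : ℝ → ℝ), HasDeriv Ω z μ ∧ IsPreciseRep Ω (posInd u) w ∧
    LocallyIntegrableOn w Ω μ.var ∧
    ∀ φ, IsTest Ω φ → μ.integral φ = μ.integral (fun x => w x * φ x)

/-- The functions `u` and `v` represent different elements of `L^1(]-1,1[)`. -/
def Different (u v : ℝ → ℝ) : Prop := ¬ u =ᵐ[volume.restrict (Ioo (-1) 1)] v

/-! ### First example -/

/-- `χ_{]-1/2,1/2[}` -/
def f₁ : ℝ → ℝ := indicator (Ioo (-1/2) (1/2)) 1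

def z₁₁ (x : ℝ) : ℝ := if x < -1/2 then 1 else if x ≤ 1/2 then -2 * x else -1

def z₁₂ (x : ℝ) : ℝ := if x < -1/2 then 2 * (x + 1) else if x ≤ 1/2 then -2 * x else 2 * (x - 1)

def u₁₁ (_ : ℝ) : ℝ := 1/2

def u₁₂ : ℝ → ℝ := indicator (Ioo (-1/2) (1/2)) (fun _ => 1/2)

/-! ### Second example -/

def f₂ (x : ℝ) : ℝ := if 1/2 ≤ x then x - 1/2 else if -1/2 < x then 0 else -x - 1/2

def z₂₁ (x : ℝ) : ℝ :=
  if 1/2 ≤ x then -4 * x ^ 2 + 4 * x - 1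
  else if -1/2 < x then 0
  else 4 * x ^ 2 + 4 * x + 1

def z₂₂ (x : ℝ) : ℝ :=
  if 1/2 ≤ x then -8 * x ^ 2 + 8 * x - 1
  else if -1/2 < x then 2 * x
  else 8 * x ^ 2 + 8 * x + 1

def z₂₃ (x : ℝ) : ℝ :=
  if 1/2 ≤ x then -8 * x ^ 2 + 8 * x - 1
  else if 1/4 ≤ x then 1
  else if -1/4 < x then 4 * x
  else if -1/2 < x then -1
  else 8 * x ^ 2 + 8 * x + 1

def u₂₁ (_ : ℝ) : ℝ := 1/8

def u₂₂ : ℝ → ℝ := indicator {x | 0 < f₂ x} (fun _ => 1/16)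

def u₂₃ : ℝ → ℝ := indicator (Ioo (-1) (-1/4) ∪ Ioo (1/4) 1) (fun _ => 1/16)

end OneLap

end

/-! Every field in the examples is continuous and piecewise polynomial, so `z'` is a bounded density
`g`. Every solution `u`, like its positivity set's indicator, is a difference `A - B` of
nondecreasing functions such that `z = 1` almost everywhere for `dA` and `z = -1` almost everywhere
for `dB`. This is `IsOriented`, and it makes `z Dv = |Dv|` literally true.

Integrating `v` by parts against `(zψ)'` then gives the Green formula `IsOriented.green`: the
derivative of `vz` is `|Dv| + g v dx`, with boundary values `v z` at the endpoints. Compactly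
supported `ψ` yield the pairing identities; general `ψ` yield the normal traces. The boundary
condition becomes `u(a)(1 - z(a)) = 0` and `u(b)(1 + z(b)) = 0` for the traces of `u`, and the
equation becomes `f/u = -g` almost everywhere on `{u > 0}`, with `f/u = 0` elsewhere. The criterion
`isWeakSolutionWith_of_isOriented` collects this, and each example is a check of its hypotheses.

Nonuniqueness has two sources. Where `z = ±1` and `f = 0`, `u` may vary monotonically without
affecting the equation. And where `u = 0`, `z` is free: it can climb back from `-1` to `1` inside a
gap. In the second example the mass of `f` on each side is `1/8`; without a gap `z` drops by `1` on
each side and `u = 1/8`, while with a gap it drops by `2` and `u = 1/16`.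

For the failure of `z' = z' χ*`, `not_derivCarried` tests with a bump on an interval where `u = 0`
but `z'` is a nonzero constant. -/

noncomputable section

namespace OneLap

/-! ### Signed Radon measures -/

namespace RadonMeasure

variable {Ω : Set ℝ}

/-- The Radon measure `α - β`, for finite positive measures `α`, `β` concentrated on `Ω`. -/
def ofSub (α β : Measure ℝ) [IsFiniteMeasure α] [IsFiniteMeasure β] (hα : α Ωᶜ = 0)
    (hβ : β Ωᶜ = 0) : RadonMeasure Ω where
  pos := α - β
  neg := β - α
  pos_conc := le_antisymm ((Measure.sub_le _).trans hα.le) zero_le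
  neg_conc := le_antisymm ((Measure.sub_le _).trans hβ.le) zero_le
  pos_lt_top _ _ _ := measure_lt_top _ _
  neg_lt_top _ _ _ := measure_lt_top _ _
  sing := Measure.mutually_singular_measure_sub

section ofSub

variable {α β : Measure ℝ} [IsFiniteMeasure α] [IsFiniteMeasure β] {hα : α Ωᶜ = 0} {hβ : β Ωᶜ = 0}

lemma ofSub_var_le : (ofSub α β hα hβ).var ≤ α + β :=
  add_le_add Measure.sub_le Measure.sub_le

lemma ofSub_finite : (ofSub α β hα hβ).Finite :=
  (ofSub_var_le _).trans_lt (measure_lt_top _ _)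

lemma ofSub_integral {F : ℝ → ℝ} (hFα : Integrable F α) (hFβ : Integrable F β) :
    (ofSub α β hα hβ).integral F = (∫ x, F x ∂α) - ∫ x, F x ∂β := by
  -- Subtraction of measures is truncated, so this balance is checked among signed measures, where
  -- subtraction is genuine.
  have key : (α - β) + β = (β - α) + α := by
    have h := Measure.sub_toSignedMeasure_eq_toSignedMeasure_sub (μ := α) (ν := β)
    rw [← Measure.toSignedMeasure_eq_toSignedMeasure_iff, Measure.toSignedMeasure_add,
      Measure.toSignedMeasure_add, add_comm (β - α).toSignedMeasure]
    rw [sub_eq_sub_iff_add_eq_add] at h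
    exact h.symm
  have hp : Integrable F (α - β) := hFα.mono_measure Measure.sub_le
  have hn : Integrable F (β - α) := hFβ.mono_measure Measure.sub_le
  have h := congrArg (fun m : Measure ℝ => ∫ x, F x ∂m) key
  simp only [integral_add_measure hp hFβ, integral_add_measure hn hFα] at h
  simp only [integral, ofSub]
  linarith

end ofSub

/-- The Radon measure given by two mutually singular finite measures concentrated on `Ω`. -/
def ofSing (α β : Measure ℝ) [IsFiniteMeasure α] [IsFiniteMeasure β] (hα : α Ωᶜ = 0)
    (hβ : β Ωᶜ = 0) (h : α ⟂ₘ β) : RadonMeasure Ω where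
  pos := α
  neg := β
  pos_conc := hα
  neg_conc := hβ
  pos_lt_top _ _ _ := measure_lt_top _ _
  neg_lt_top _ _ _ := measure_lt_top _ _
  sing := h

end RadonMeasure

/-! ### Measures with a density -/

/-- The part of the measure `g dx` on `Ω` where `g` is positive. -/
def posDensity (Ω : Set ℝ) (g : ℝ → ℝ) : Measure ℝ :=
  (volume.restrict Ω).withDensity fun x => ENNReal.ofReal (g x)

section density

variable {Ω : Set ℝ} {g F : ℝ → ℝ}

lemma posDensity_compl (hΩ : MeasurableSet Ω) (g : ℝ → ℝ) : posDensity Ω g Ωᶜ = 0 :=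
  withDensity_absolutelyContinuous _ _ (by rw [Measure.restrict_apply hΩ.compl]; simp)

lemma isFiniteMeasure_posDensity (hg : IntegrableOn g Ω) : IsFiniteMeasure (posDensity Ω g) :=
  isFiniteMeasure_withDensity_ofReal hg.2

lemma integrable_posDensity (hg : Measurable g) (hF : IntegrableOn (fun x => g x * F x) Ω)
    (hFm : AEStronglyMeasurable F (volume.restrict Ω)) : Integrable F (posDensity Ω g) := by
  rw [posDensity, integrable_withDensity_iff_integrable_smul' hg.ennreal_ofReal (by simp)]
  refine Integrable.mono hF (hg.ennreal_ofReal.ennreal_toReal.aestronglyMeasurable.smul hFm)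
    (Eventually.of_forall fun x => ?_)
  simp only [smul_eq_mul, norm_mul]
  gcongr
  rw [ENNReal.toReal_ofReal', Real.norm_eq_abs, Real.norm_eq_abs]
  rcases le_total 0 (g x) with h | h <;> simp [h]

lemma integral_posDensity_sub (hg : Measurable g) (hF : IntegrableOn (fun x => g x * F x) Ω)
    (hFm : AEStronglyMeasurable F (volume.restrict Ω)) :
    (∫ x, F x ∂posDensity Ω g) - ∫ x, F x ∂posDensity Ω (fun x => -g x)
      = ∫ x in Ω, g x * F x := by
  have hp := integrable_posDensity hg hF hFm
  have hn := integrable_posDensity (g := fun x => -g x) hg.neg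
    (by simp only [neg_mul]; exact hF.neg) hFm
  rw [posDensity, integrable_withDensity_iff_integrable_smul' (by fun_prop) (by simp)] at hp hn
  rw [posDensity, posDensity, integral_withDensity_eq_integral_toReal_smul (by fun_prop) (by simp),
    integral_withDensity_eq_integral_toReal_smul (by fun_prop) (by simp), ← integral_sub hp hn]
  congr 1 with x
  rw [ENNReal.toReal_ofReal', ENNReal.toReal_ofReal', smul_eq_mul, smul_eq_mul, ← sub_mul]
  congr 1
  rcases le_total 0 (g x) with h | h <;> simp [h]

end density

/-! ### Primitives and integration by parts -/

/-- `h` is continuous on `[a,b]` and has the integrable derivative `h'` off a countable set. -/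
structure IsPrimitive (a b : ℝ) (h h' : ℝ → ℝ) : Prop where
  cont : ContinuousOn h (Icc a b)
  int : IntegrableOn h' (Ioo a b)
  deriv : ∃ s : Set ℝ, s.Countable ∧ ∀ x ∈ Ioo a b \ s, HasDerivAt h (h' x) x

section primitive

variable {a b : ℝ} {h h' z g ψ : ℝ → ℝ}

lemma IsPrimitive.integral_eq (H : IsPrimitive a b h h') {t : ℝ} (ht : t ∈ Icc a b) :
    ∫ x in Ioo a t, h' x = h t - h a := by
  obtain ⟨s, hs, hd⟩ := H.deriv
  rw [← integral_Ioc_eq_integral_Ioo, ← intervalIntegral.integral_of_le ht.1]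
  refine integral_eq_of_hasDerivAt_off_countable_of_le h h' ht.1 hs
    (H.cont.mono (Icc_subset_Icc_right ht.2))
    (fun x hx => hd x ⟨⟨hx.1.1, hx.1.2.trans_le ht.2⟩, hx.2⟩) ?_
  rw [intervalIntegrable_iff_integrableOn_Ioo_of_le ht.1]
  exact H.int.mono_set (Ioo_subset_Ioo_right ht.2)

lemma integrableOn_mul_of_continuousOn (hg : IntegrableOn g (Ioo a b))
    (hψ : ContinuousOn ψ (Icc a b)) : IntegrableOn (fun x => g x * ψ x) (Ioo a b) := by
  rw [← integrableOn_Icc_iff_integrableOn_Ioo] at hg ⊢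
  exact hg.mul_continuousOn hψ isCompact_Icc

lemma IsPrimitive.of_contDiff (hψ : ContDiff ℝ ∞ ψ) : IsPrimitive a b ψ (_root_.deriv ψ) where
  cont := hψ.continuous.continuousOn
  int := ((hψ.continuous_deriv (by simp)).integrableOn_Icc).mono_set Ioo_subset_Icc_self
  deriv := ⟨∅, countable_empty, fun x _ => (hψ.differentiable (by simp) x).hasDerivAt⟩

lemma IsPrimitive.mul_contDiff (H : IsPrimitive a b z g) (hψ : ContDiff ℝ ∞ ψ) :
    IsPrimitive a b (fun x => z x * ψ x) (fun x => g x * ψ x + z x * _root_.deriv ψ x) where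
  cont := H.cont.mul hψ.continuous.continuousOn
  int := (integrableOn_mul_of_continuousOn H.int hψ.continuous.continuousOn).add
    ((H.cont.mul (hψ.continuous_deriv (by simp)).continuousOn).integrableOn_Icc.mono_set
      Ioo_subset_Icc_self)
  deriv := by
    obtain ⟨s, hs, hd⟩ := H.deriv
    exact ⟨s, hs, fun x hx => (hd x hx).mul (hψ.differentiable (by simp) x).hasDerivAt⟩

lemma IsTest.eq_zero {Ω : Set ℝ} {φ : ℝ → ℝ} (hφ : IsTest Ω φ) {x : ℝ} (hx : x ∉ Ω) : φ x = 0 :=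
  image_eq_zero_of_notMem_tsupport fun h => hx (hφ.supp h)

lemma IsPrimitive.integral_mul_deriv (hab : a ≤ b) (H : IsPrimitive a b z g) {φ : ℝ → ℝ}
    (hφ : IsTest (Ioo a b) φ) :
    ∫ x in Ioo a b, z x * _root_.deriv φ x = -∫ x in Ioo a b, g x * φ x := by
  have h := (H.mul_contDiff hφ.smooth).integral_eq (right_mem_Icc.2 hab)
  have hi : IntegrableOn (fun x => z x * _root_.deriv φ x) (Ioo a b) :=
    (H.cont.mul (hφ.smooth.continuous_deriv (by simp)).continuousOn).integrableOn_Icc.mono_set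
      Ioo_subset_Icc_self
  rw [hφ.eq_zero (x := a) (by simp), hφ.eq_zero (x := b) (by simp), integral_add
    (integrableOn_mul_of_continuousOn H.int hφ.smooth.continuous.continuousOn) hi] at h
  linarith

/-- Fubini's theorem for the primitive of a function against a measure. -/
lemma IsPrimitive.integral_measure_Ioi_mul (H : IsPrimitive a b h h') {μ : Measure ℝ}
    [IsFiniteMeasure μ] (hμ : μ (Ioo a b)ᶜ = 0) :
    ∫ x in Ioo a b, μ.real (Ioi x) * h' x = ∫ t, (h t - h a) ∂μ := by
  -- Integrate `h' x` over the region `x < t`: integrating in `t` first leaves the weight `μ (Ioi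
  -- x)`, integrating in `x` first leaves `h t - h a`.
  have hS : MeasurableSet {p : ℝ × ℝ | p.1 < p.2} := measurableSet_lt measurable_fst measurable_snd
  have hint : Integrable ({p : ℝ × ℝ | p.1 < p.2}.indicator fun p => h' p.1)
      ((volume.restrict (Ioo a b)).prod μ) :=
    (Integrable.comp_fst H.int μ).indicator hS
  have hsw := integral_integral_swap
    (f := fun x t => {p : ℝ × ℝ | p.1 < p.2}.indicator (fun p => h' p.1) (x, t)) hint
  have e1 : ∀ x, ∫ t, {p : ℝ × ℝ | p.1 < p.2}.indicator (fun p => h' p.1) (x, t) ∂μ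
      = μ.real (Ioi x) * h' x := by
    intro x
    have : (fun t => {p : ℝ × ℝ | p.1 < p.2}.indicator (fun p => h' p.1) (x, t))
        = (Ioi x).indicator fun _ => h' x := by
      ext t; simp [indicator]
    rw [this, integral_indicator measurableSet_Ioi, setIntegral_const, smul_eq_mul]
  simp only [e1] at hsw
  rw [hsw]
  refine integral_congr_ae ?_
  filter_upwards [compl_mem_ae_iff.2 hμ] with t ht
  have ht' : t ∈ Ioo a b := not_not.1 ht
  have : (fun x => {p : ℝ × ℝ | p.1 < p.2}.indicator (fun p => h' p.1) (x, t))
      = (Iio t).indicator h' := by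
    ext x; simp [indicator]
  rw [this, setIntegral_indicator measurableSet_Iio, Ioo_inter_Iio, min_eq_right ht'.2.le,
    H.integral_eq (Ioo_subset_Icc_self ht')]

end primitive

/-! ### Differences of monotone functions -/

/-- The derivative, as a measure on `]a,b[`, of a nondecreasing function. -/
def monoDeriv (a b : ℝ) {A : ℝ → ℝ} (hA : Monotone A) : Measure ℝ :=
  hA.stieltjesFunction.measure.restrict (Ioo a b)

section monotone

variable {a b : ℝ} {A : ℝ → ℝ}

/-- The Stieltjes function of `A` is its right-limit function; this recovers the left limits of `A`
itself in the measure of an open interval. -/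
lemma leftLim_rightLim_eq (hA : Monotone A) (x : ℝ) :
    Function.leftLim (Function.rightLim A) x = Function.leftLim A x :=
  _root_.leftLim_rightLim (hA.tendsto_leftLim x)

lemma ae_leftLim_eq (hA : Monotone A) : ∀ᵐ x, Function.leftLim A x = A x := by
  filter_upwards [hA.countable_not_continuousAt.ae_notMem volume] with x hx
  exact (not_not.1 hx).continuousWithinAt.leftLim_eq

lemma ae_rightLim_eq (hA : Monotone A) : ∀ᵐ x, Function.rightLim A x = A x := by
  filter_upwards [hA.countable_not_continuousAt.ae_notMem volume] with x hx
  exact (not_not.1 hx).continuousWithinAt.rightLim_eq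

lemma stieltjes_Ioo (hA : Monotone A) (x y : ℝ) : hA.stieltjesFunction.measure (Ioo x y)
    = ENNReal.ofReal (Function.leftLim A y - Function.rightLim A x) := by
  rw [StieltjesFunction.measure_Ioo, hA.stieltjesFunction_eq]
  congr 2
  exact leftLim_rightLim_eq hA y

instance (hA : Monotone A) : IsFiniteMeasure (monoDeriv a b hA) :=
  ⟨by simp [monoDeriv]⟩

lemma monoDeriv_compl (hA : Monotone A) : monoDeriv a b hA (Ioo a b)ᶜ = 0 := by
  rw [monoDeriv, Measure.restrict_apply measurableSet_Ioo.compl]; simp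

/-- The measure of an open interval sees only the limits at its endpoints taken from inside, so
jumps at `p` and `q` do not count. -/
lemma monoDeriv_eq_zero_of_const (hA : Monotone A) {p q c : ℝ} (h : ∀ x ∈ Ioo p q, A x = c) :
    monoDeriv a b hA (Ioo p q) = 0 := by
  refine le_antisymm ((Measure.restrict_apply_le _ _).trans ?_) zero_le
  rcases le_or_gt q p with hpq | hpq
  · simp [Ioo_eq_empty_of_le hpq]
  have hl : Function.leftLim A q = c := leftLim_eq_of_tendsto (tendsto_const_nhds.congr' (by
      filter_upwards [Ioo_mem_nhdsLT hpq] with x hx using (h x hx).symm))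
  have hr : Function.rightLim A p = c := rightLim_eq_of_tendsto (tendsto_const_nhds.congr' (by
      filter_upwards [Ioo_mem_nhdsGT hpq] with x hx using (h x hx).symm))
  rw [stieltjes_Ioo, hl, hr]; simp

lemma monoDeriv_real_Ioi (hA : Monotone A) {x : ℝ} (hx : x ∈ Ico a b) :
    (monoDeriv a b hA).real (Ioi x) = Function.leftLim A b - Function.rightLim A x := by
  rw [monoDeriv, measureReal_restrict_apply measurableSet_Ioi, inter_comm, Ioo_inter_Ioi,
    sup_eq_right.2 hx.1, Measure.real, stieltjes_Ioo,
    ENNReal.toReal_ofReal (sub_nonneg.2 (hA.rightLim_le_leftLim hx.2))]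

lemma integrable_monoDeriv (hA : Monotone A) {F : ℝ → ℝ} (hF : ContinuousOn F (Icc a b)) :
    Integrable F (monoDeriv a b hA) := by
  obtain ⟨C, hC⟩ := isCompact_Icc.exists_bound_of_continuousOn hF
  refine Integrable.of_bound (C := C)
    ((hF.mono Ioo_subset_Icc_self).aestronglyMeasurable measurableSet_Ioo) ?_
  filter_upwards [ae_restrict_mem measurableSet_Ioo] with x hx using hC x (Ioo_subset_Icc_self hx)

lemma norm_le_of_monotone (hA : Monotone A) {x : ℝ} (hx : x ∈ Icc a b) :
    |A x| ≤ |A a| + |A b| := by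
  rw [abs_le]
  have h1 := hA hx.1
  have h2 := hA hx.2
  constructor <;> linarith [neg_abs_le (A a), le_abs_self (A b), abs_nonneg (A a), abs_nonneg (A b)]

lemma integrableOn_monotone_mul (hA : Monotone A) {F : ℝ → ℝ} (hF : IntegrableOn F (Ioo a b)) :
    IntegrableOn (fun x => A x * F x) (Ioo a b) := by
  refine Integrable.bdd_mul (c := |A a| + |A b|) hF hA.measurable.aestronglyMeasurable ?_
  filter_upwards [ae_restrict_mem measurableSet_Ioo] with x hx
    using norm_le_of_monotone hA (Ioo_subset_Icc_self hx)

/-- Integration by parts against a monotone function. -/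
lemma IsPrimitive.integral_monotone_mul (hab : a < b) {h h' : ℝ → ℝ} (H : IsPrimitive a b h h')
    (hA : Monotone A) :
    ∫ x in Ioo a b, A x * h' x = Function.leftLim A b * h b - Function.rightLim A a * h a
      - ∫ t, h t ∂monoDeriv a b hA := by
  -- Fubini with `μ = dA`, for which `μ (Ioi x)` is the left limit of `A` at `b` minus the right
  -- limit at `x`; the latter is `A x` for almost every `x`.
  have h1 := H.integral_measure_Ioi_mul (monoDeriv_compl (a := a) (b := b) hA)
  have h2 : ∫ x in Ioo a b, (monoDeriv a b hA).real (Ioi x) * h' x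
      = ∫ x in Ioo a b, (Function.leftLim A b * h' x - A x * h' x) := by
    refine integral_congr_ae ?_
    filter_upwards [ae_restrict_mem measurableSet_Ioo, ae_restrict_of_ae (ae_rightLim_eq hA)]
      with x hx hx'
    rw [monoDeriv_real_Ioi hA (Ioo_subset_Ico_self hx), hx', sub_mul]
  rw [integral_sub (H.int.const_mul _) (integrableOn_monotone_mul hA H.int), integral_const_mul,
    H.integral_eq (right_mem_Icc.2 hab.le)] at h2
  have h3 : (monoDeriv a b hA).real univ = Function.leftLim A b - Function.rightLim A a := by
    rw [monoDeriv, measureReal_restrict_apply MeasurableSet.univ, univ_inter, Measure.real,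
      stieltjes_Ioo, ENNReal.toReal_ofReal (sub_nonneg.2 (hA.rightLim_le_leftLim hab))]
  rw [integral_sub (integrable_monoDeriv hA H.cont) (integrable_const _), integral_const, h3,
    smul_eq_mul] at h1
  linarith

end monotone

/-! ### Approximate limits -/

section approx

variable {v : ℝ → ℝ} {x c p q : ℝ}

lemma ApproxLimRight.of_tendsto (h : Tendsto v (𝓝[>] x) (𝓝 c)) : ApproxLimRight v x c := by
  rw [ApproxLimRight, Metric.tendsto_nhds]
  intro ε hε
  obtain ⟨r, hr, hv⟩ := (mem_nhdsGT_iff_exists_Ioo_subset.1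
    (h (Metric.ball_mem_nhds c (half_pos hε))))
  filter_upwards [Ioo_mem_nhdsGT (sub_pos.2 hr)] with ρ hρ
  have hb := norm_setIntegral_le_of_norm_le_const (μ := volume) (s := Ioo x (x + ρ))
    (f := fun y => |v y - c|) (C := ε / 2) (by simp) (fun y hy => by
      have := hv ⟨hy.1, by linarith [hy.2, hρ.2]⟩
      simpa [Real.dist_eq] using (le_of_lt this))
  rw [Real.volume_real_Ioo_of_le (by linarith [hρ.1])] at hb
  rw [dist_zero_right, norm_mul, norm_inv, Real.norm_of_nonneg hρ.1.le, inv_mul_lt_iff₀ hρ.1]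
  have := hρ.1
  nlinarith

lemma ApproxLimLeft.of_tendsto (h : Tendsto v (𝓝[<] x) (𝓝 c)) : ApproxLimLeft v x c := by
  rw [ApproxLimLeft, Metric.tendsto_nhds]
  intro ε hε
  obtain ⟨r, hr, hv⟩ := (mem_nhdsLT_iff_exists_Ioo_subset.1
    (h (Metric.ball_mem_nhds c (half_pos hε))))
  filter_upwards [Ioo_mem_nhdsGT (sub_pos.2 hr)] with ρ hρ
  have hb := norm_setIntegral_le_of_norm_le_const (μ := volume) (s := Ioo (x - ρ) x)
    (f := fun y => |v y - c|) (C := ε / 2) (by simp) (fun y hy => by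
      have := hv ⟨by linarith [hy.1, hρ.2], hy.2⟩
      simpa [Real.dist_eq] using (le_of_lt this))
  rw [Real.volume_real_Ioo_of_le (by linarith [hρ.1])] at hb
  rw [dist_zero_right, norm_mul, norm_inv, Real.norm_of_nonneg hρ.1.le, inv_mul_lt_iff₀ hρ.1]
  have := hρ.1
  nlinarith

lemma ApproxLim.of_tendsto (h : Tendsto v (𝓝[≠] x) (𝓝 c)) : ApproxLim v x c := by
  rw [ApproxLim, Metric.tendsto_nhds]
  intro ε hε
  obtain ⟨r, hr, hv⟩ := (Metric.mem_nhdsWithin_iff.1 (h (Metric.ball_mem_nhds c (half_pos hε))))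
  filter_upwards [Ioo_mem_nhdsGT hr] with ρ hρ
  -- The punctured limit gives no control at `x` itself, which is a null set.
  have hb := norm_setIntegral_le_of_norm_le_const_ae' (μ := volume) (s := Ioo (x - ρ) (x + ρ))
    (f := fun y => |v y - c|) (C := ε / 2) (by simp) (by
      filter_upwards [(countable_singleton x).ae_notMem volume] with y hyx hy
      have : y ∈ v ⁻¹' Metric.ball c (ε / 2) := hv ⟨by
        rw [Metric.mem_ball, Real.dist_eq, abs_lt]
        constructor <;> linarith [hy.1, hy.2, hρ.2], hyx⟩
      simpa [Real.dist_eq] using (le_of_lt this))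
  rw [Real.volume_real_Ioo_of_le (by linarith [hρ.1])] at hb
  have hρ' : 0 < 2 * ρ := by linarith [hρ.1]
  rw [dist_zero_right, norm_mul, norm_inv, Real.norm_of_nonneg hρ'.le, inv_mul_lt_iff₀ hρ']
  nlinarith

/-- Equal one-sided limits make `x` a Lebesgue point, unequal ones a jump point; the mean is the
right value either way. -/
lemma PreciseValue.of_tendsto (hl : Tendsto v (𝓝[<] x) (𝓝 p)) (hr : Tendsto v (𝓝[>] x) (𝓝 q)) :
    PreciseValue v x ((p + q) / 2) := by
  by_cases hpq : p = q
  · subst hpq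
    left
    rw [add_self_div_two]
    refine ApproxLim.of_tendsto ?_
    rw [← Iio_union_Ioi, nhdsWithin_union]
    exact hl.sup hr
  · exact Or.inr ⟨p, q, hpq, .of_tendsto hl, .of_tendsto hr, rfl⟩

/-- The precise representative of a function that vanishes near `x` is `0` at `x`. -/
lemma PreciseValue.eq_zero_of_eventually (h : PreciseValue v x c) {r : ℝ} (hr : 0 < r)
    (hv : ∀ y ∈ Ioo (x - r) (x + r), v y = 0) : c = 0 := by
  rcases h with h | ⟨p, q, hpq, hp, hq, -⟩
  -- For small `ρ` the average of `|v - c|` is exactly `|c|`, so its limit can be `0` only if `c =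
  -- 0`.
  · have : Tendsto (fun _ : ℝ => |c|) (𝓝[>] (0 : ℝ)) (𝓝 0) := by
      refine h.congr' ?_
      filter_upwards [Ioo_mem_nhdsGT hr] with ρ hρ
      have e : ∫ y in Ioo (x - ρ) (x + ρ), |v y - c| = ∫ y in Ioo (x - ρ) (x + ρ), |c| :=
        setIntegral_congr_fun measurableSet_Ioo fun y hy => by
          simp [hv y ⟨by linarith [hy.1, hρ.2], by linarith [hy.2, hρ.2]⟩]
      have := hρ.1
      rw [e, setIntegral_const, Real.volume_real_Ioo_of_le (by linarith), smul_eq_mul]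
      field_simp
      ring
    exact abs_eq_zero.1 (tendsto_nhds_unique tendsto_const_nhds this)
  -- At a jump point the same computation on each side forces `p = q = 0`.
  · exfalso
    have h1 : Tendsto (fun _ : ℝ => |p|) (𝓝[>] (0 : ℝ)) (𝓝 0) := by
      refine hp.congr' ?_
      filter_upwards [Ioo_mem_nhdsGT hr] with ρ hρ
      have e : ∫ y in Ioo (x - ρ) x, |v y - p| = ∫ y in Ioo (x - ρ) x, |p| :=
        setIntegral_congr_fun measurableSet_Ioo fun y hy => by
          simp [hv y ⟨by linarith [hy.1, hρ.2], by linarith [hy.2, hr]⟩]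
      have := hρ.1
      rw [e, setIntegral_const, Real.volume_real_Ioo_of_le (by linarith), smul_eq_mul]
      field_simp
      ring
    have h2 : Tendsto (fun _ : ℝ => |q|) (𝓝[>] (0 : ℝ)) (𝓝 0) := by
      refine hq.congr' ?_
      filter_upwards [Ioo_mem_nhdsGT hr] with ρ hρ
      have e : ∫ y in Ioo x (x + ρ), |v y - q| = ∫ y in Ioo x (x + ρ), |q| :=
        setIntegral_congr_fun measurableSet_Ioo fun y hy => by
          simp [hv y ⟨by linarith [hy.1, hr], by linarith [hy.2, hρ.2]⟩]
      have := hρ.1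
      rw [e, setIntegral_const, Real.volume_real_Ioo_of_le (by linarith), smul_eq_mul]
      field_simp
      ring
    exact hpq ((abs_eq_zero.1 (tendsto_nhds_unique tendsto_const_nhds h1)).trans
      (abs_eq_zero.1 (tendsto_nhds_unique tendsto_const_nhds h2)).symm)

end approx

/-! ### Absolutely continuous measures as Radon measures -/

/-- The Radon measure `g dx` on `Ω`. -/
def RadonMeasure.ofDensity {Ω : Set ℝ} (hΩ : MeasurableSet Ω) {g : ℝ → ℝ}
    (hg : IntegrableOn g Ω) : RadonMeasure Ω :=
  haveI := isFiniteMeasure_posDensity hg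
  haveI : IsFiniteMeasure (posDensity Ω fun x => -g x) := isFiniteMeasure_posDensity hg.neg
  .ofSub (posDensity Ω g) (posDensity Ω fun x => -g x) (posDensity_compl hΩ _)
    (posDensity_compl hΩ _)

section ofDensity

variable {Ω : Set ℝ} {hΩ : MeasurableSet Ω} {g F : ℝ → ℝ} {hgi : IntegrableOn g Ω}

lemma integrable_posDensity_neg (hg : Measurable g) (hF : IntegrableOn (fun x => g x * F x) Ω)
    (hFm : AEStronglyMeasurable F (volume.restrict Ω)) :
    Integrable F (posDensity Ω fun x => -g x) :=
  integrable_posDensity (g := fun x => -g x) hg.neg (by simp only [neg_mul]; exact hF.neg) hFm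

lemma RadonMeasure.ofDensity_integral (hg : Measurable g)
    (hF : IntegrableOn (fun x => g x * F x) Ω)
    (hFm : AEStronglyMeasurable F (volume.restrict Ω)) :
    (RadonMeasure.ofDensity hΩ hgi).integral F = ∫ x in Ω, g x * F x := by
  have := isFiniteMeasure_posDensity hgi
  have : IsFiniteMeasure (posDensity Ω fun x => -g x) := isFiniteMeasure_posDensity hgi.neg
  rw [RadonMeasure.ofDensity, RadonMeasure.ofSub_integral (integrable_posDensity hg hF hFm)
    (integrable_posDensity_neg hg hF hFm), integral_posDensity_sub hg hF hFm]

lemma RadonMeasure.integrable_ofDensity_var (hg : Measurable g)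
    (hF : IntegrableOn (fun x => g x * F x) Ω)
    (hFm : AEStronglyMeasurable F (volume.restrict Ω)) :
    Integrable F (RadonMeasure.ofDensity hΩ hgi).var := by
  have := isFiniteMeasure_posDensity hgi
  have : IsFiniteMeasure (posDensity Ω fun x => -g x) := isFiniteMeasure_posDensity hgi.neg
  exact ((integrable_posDensity hg hF hFm).add_measure
    (integrable_posDensity_neg hg hF hFm)).mono_measure RadonMeasure.ofSub_var_le

lemma IsPrimitive.hasDeriv {a b : ℝ} (hab : a ≤ b) {z : ℝ → ℝ} (H : IsPrimitive a b z g)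
    (hg : Measurable g) :
    HasDeriv (Ioo a b) z (RadonMeasure.ofDensity measurableSet_Ioo H.int) := by
  intro φ hφ
  rw [H.integral_mul_deriv hab hφ, RadonMeasure.ofDensity_integral hg
    (integrableOn_mul_of_continuousOn H.int hφ.smooth.continuous.continuousOn)
    hφ.smooth.continuous.aestronglyMeasurable]

end ofDensity

/-! ### Functions of bounded variation whose derivative is oriented by a field -/

/-- On `]a,b[` the function `v` is the difference of the nondecreasing functions `A` and `B`, and
the field `z` is `1` on the support of `A'` and `-1` on the support of `B'`. -/
structure IsOriented (a b : ℝ) (z v A B : ℝ → ℝ) : Prop where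
  pos : Monotone A
  neg : Monotone B
  eq : ∀ x ∈ Ioo a b, v x = A x - B x
  ae_pos : ∀ᵐ x ∂monoDeriv a b pos, z x = 1
  ae_neg : ∀ᵐ x ∂monoDeriv a b neg, z x = -1

/-- The mean of the one-sided limits of `A - B`. -/
def meanLim (A B : ℝ → ℝ) (x : ℝ) : ℝ :=
  ((Function.leftLim A x - Function.leftLim B x)
    + (Function.rightLim A x - Function.rightLim B x)) / 2

namespace IsOriented

variable {a b : ℝ} {z g v A B : ℝ → ℝ}

/-- The sets `{z ≠ 1}` and `{z ≠ -1}` cover the line, and each is null for one of the two measures.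
-/
lemma singular (H : IsOriented a b z v A B) :
    monoDeriv a b H.pos ⟂ₘ monoDeriv a b H.neg := by
  refine Measure.MutuallySingular.mk (s := {x | ¬ z x = 1}) (t := {x | ¬ z x = -1})
    (ae_iff.1 H.ae_pos) (ae_iff.1 H.ae_neg) fun x _ => ?_
  by_cases h : z x = 1
  · right; simp only [mem_ofPred_eq, h]; norm_num
  · exact Or.inl h

/-- The distributional derivative of `v`. -/
def grad (H : IsOriented a b z v A B) : RadonMeasure (Ioo a b) :=
  .ofSing (monoDeriv a b H.pos) (monoDeriv a b H.neg) (monoDeriv_compl _) (monoDeriv_compl _)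
    H.singular

lemma grad_finite (H : IsOriented a b z v A B) : H.grad.Finite :=
  measure_lt_top (monoDeriv a b H.pos + monoDeriv a b H.neg) _

lemma integrableOn_mul (H : IsOriented a b z v A B) {F : ℝ → ℝ}
    (hF : IntegrableOn F (Ioo a b)) : IntegrableOn (fun x => v x * F x) (Ioo a b) := by
  refine ((integrableOn_monotone_mul H.pos hF).sub (integrableOn_monotone_mul H.neg hF)).congr_fun
    (fun x hx => ?_) measurableSet_Ioo
  simp [H.eq x hx, sub_mul]

lemma integrableOn (H : IsOriented a b z v A B) : IntegrableOn v (Ioo a b) := by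
  simpa using H.integrableOn_mul (F := fun _ => 1) (integrableOn_const (by simp))

lemma bound (H : IsOriented a b z v A B) :
    ∃ C, ∀ x ∈ Ioo a b, |v x| ≤ C := by
  refine ⟨(|A a| + |A b|) + (|B a| + |B b|), fun x hx => ?_⟩
  rw [H.eq x hx]
  exact (abs_sub _ _).trans (add_le_add (norm_le_of_monotone H.pos (Ioo_subset_Icc_self hx))
    (norm_le_of_monotone H.neg (Ioo_subset_Icc_self hx)))

lemma memLp_top (H : IsOriented a b z v A B) : MemLp v ⊤ (volume.restrict (Ioo a b)) := by
  obtain ⟨C, hC⟩ := H.bound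
  exact memLp_top_of_bound H.integrableOn.aestronglyMeasurable C
    ((ae_restrict_iff' measurableSet_Ioo).2 (Eventually.of_forall hC))

lemma integral_mul (hab : a < b) (H : IsOriented a b z v A B) {h h' : ℝ → ℝ}
    (Hh : IsPrimitive a b h h') :
    ∫ x in Ioo a b, v x * h' x
      = (Function.leftLim A b - Function.leftLim B b) * h b
        - (Function.rightLim A a - Function.rightLim B a) * h a
        - ((∫ t, h t ∂monoDeriv a b H.pos) - ∫ t, h t ∂monoDeriv a b H.neg) := by
  have e : ∫ x in Ioo a b, v x * h' x = ∫ x in Ioo a b, (A x * h' x - B x * h' x) :=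
    setIntegral_congr_fun measurableSet_Ioo fun x hx => by simp [H.eq x hx, sub_mul]
  rw [e, integral_sub (integrableOn_monotone_mul H.pos Hh.int)
    (integrableOn_monotone_mul H.neg Hh.int), Hh.integral_monotone_mul hab H.pos,
    Hh.integral_monotone_mul hab H.neg]
  ring

lemma hasDeriv (hab : a < b) (H : IsOriented a b z v A B) : HasDeriv (Ioo a b) v H.grad := by
  intro φ hφ
  rw [H.integral_mul hab (.of_contDiff hφ.smooth), hφ.eq_zero (x := a) (by simp),
    hφ.eq_zero (x := b) (by simp)]
  simp [grad, RadonMeasure.ofSing, RadonMeasure.integral]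

lemma tendsto_left (H : IsOriented a b z v A B) {x : ℝ} (hx : x ∈ Ioc a b) :
    Tendsto v (𝓝[<] x) (𝓝 (Function.leftLim A x - Function.leftLim B x)) := by
  refine ((H.pos.tendsto_leftLim x).sub (H.neg.tendsto_leftLim x)).congr' ?_
  filter_upwards [Ioo_mem_nhdsLT hx.1] with y hy
    using (H.eq y ⟨hy.1, hy.2.trans_le hx.2⟩).symm

lemma tendsto_right (H : IsOriented a b z v A B) {x : ℝ} (hx : x ∈ Ico a b) :
    Tendsto v (𝓝[>] x) (𝓝 (Function.rightLim A x - Function.rightLim B x)) := by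
  refine ((H.pos.tendsto_rightLim x).sub (H.neg.tendsto_rightLim x)).congr' ?_
  filter_upwards [Ioo_mem_nhdsGT hx.2] with y hy
    using (H.eq y ⟨hx.1.trans_lt hy.1, hy.2⟩).symm

lemma isPreciseRep (H : IsOriented a b z v A B) : IsPreciseRep (Ioo a b) v (meanLim A B) :=
  fun _ hx => .of_tendsto (H.tendsto_left (Ioo_subset_Ioc_self hx))
    (H.tendsto_right (Ioo_subset_Ico_self hx))

lemma meanLim_ae_eq (H : IsOriented a b z v A B) :
    meanLim A B =ᵐ[volume.restrict (Ioo a b)] v := by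
  filter_upwards [ae_restrict_mem measurableSet_Ioo, ae_restrict_of_ae (ae_leftLim_eq H.pos),
    ae_restrict_of_ae (ae_leftLim_eq H.neg), ae_restrict_of_ae (ae_rightLim_eq H.pos),
    ae_restrict_of_ae (ae_rightLim_eq H.neg)] with x hx h1 h2 h3 h4
  rw [meanLim, h1, h2, h3, h4, H.eq x hx, add_self_div_two]

lemma aestronglyMeasurable_meanLim (H : IsOriented a b z v A B) :
    AEStronglyMeasurable (meanLim A B) (volume.restrict (Ioo a b)) :=
  H.integrableOn.aestronglyMeasurable.congr H.meanLim_ae_eq.symm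

lemma integrableOn_mul_meanLim (H : IsOriented a b z v A B) (hg : IntegrableOn g (Ioo a b)) :
    IntegrableOn (fun x => g x * meanLim A B x) (Ioo a b) := by
  refine (H.integrableOn_mul hg).congr ?_
  filter_upwards [H.meanLim_ae_eq] with x hx
  rw [hx, mul_comm]

lemma locallyIntegrableOn_meanLim (H : IsOriented a b z v A B) (hg : Measurable g)
    (hgi : IntegrableOn g (Ioo a b)) :
    LocallyIntegrableOn (meanLim A B) (Ioo a b)
      (RadonMeasure.ofDensity measurableSet_Ioo hgi).var :=
  (RadonMeasure.integrable_ofDensity_var hg (H.integrableOn_mul_meanLim hgi)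
    H.aestronglyMeasurable_meanLim).locallyIntegrable.locallyIntegrableOn _

/-- The measure `g dx` does not charge the countably many points where the mean of the one-sided
limits may differ from `v`. -/
lemma integral_meanLim_mul (H : IsOriented a b z v A B) (hg : Measurable g)
    (hgi : IntegrableOn g (Ioo a b)) {φ : ℝ → ℝ} (hφ : ContinuousOn φ (Icc a b)) :
    (RadonMeasure.ofDensity measurableSet_Ioo hgi).integral (fun x => meanLim A B x * φ x)
      = ∫ x in Ioo a b, g x * v x * φ x := by
  rw [RadonMeasure.ofDensity_integral hg]
  · refine integral_congr_ae ?_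
    filter_upwards [H.meanLim_ae_eq] with x hx
    rw [hx, mul_assoc]
  · simpa only [mul_assoc] using
      integrableOn_mul_of_continuousOn (H.integrableOn_mul_meanLim hgi) hφ
  · exact H.aestronglyMeasurable_meanLim.mul
      ((hφ.mono Ioo_subset_Icc_self).aestronglyMeasurable measurableSet_Ioo)

/-- This is `z Dv = |Dv|`, and the only place where the orientation of `v` by `z` enters the Green
formula. -/
lemma integral_field_mul (H : IsOriented a b z v A B) (ψ : ℝ → ℝ) :
    (∫ t, z t * ψ t ∂monoDeriv a b H.pos) - ∫ t, z t * ψ t ∂monoDeriv a b H.neg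
      = (∫ t, ψ t ∂monoDeriv a b H.pos) + ∫ t, ψ t ∂monoDeriv a b H.neg := by
  have e1 : ∫ t, z t * ψ t ∂monoDeriv a b H.pos = ∫ t, ψ t ∂monoDeriv a b H.pos := by
    refine integral_congr_ae ?_
    filter_upwards [H.ae_pos] with x hx
    rw [hx, one_mul]
  have e2 : ∫ t, z t * ψ t ∂monoDeriv a b H.neg = -∫ t, ψ t ∂monoDeriv a b H.neg := by
    rw [← integral_neg]
    refine integral_congr_ae ?_
    filter_upwards [H.ae_neg] with x hx
    rw [hx, neg_one_mul]
  rw [e1, e2, sub_neg_eq_add]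

/-- The Green formula for `v z`, whose derivative is `|v'| + g v dx`. -/
lemma green (hab : a < b) (H : IsOriented a b z v A B) (Hz : IsPrimitive a b z g)
    {ψ : ℝ → ℝ} (hψ : ContDiff ℝ ∞ ψ) :
    (∫ t, ψ t ∂monoDeriv a b H.pos) + (∫ t, ψ t ∂monoDeriv a b H.neg)
        + (∫ x in Ioo a b, g x * v x * ψ x) + ∫ x in Ioo a b, v x * z x * deriv ψ x
      = (Function.leftLim A b - Function.leftLim B b) * z b * ψ b
        - (Function.rightLim A a - Function.rightLim B a) * z a * ψ a := by
  -- Since `z` has a primitive's regularity, `zψ` is admissible in the integration by parts against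
  -- `Dv`.
  have h := H.integral_mul hab (Hz.mul_contDiff hψ)
  rw [H.integral_field_mul] at h
  have i1 : IntegrableOn (fun x => g x * v x * ψ x) (Ioo a b) :=
    (H.integrableOn_mul (integrableOn_mul_of_continuousOn Hz.int
      hψ.continuous.continuousOn)).congr_fun (fun x _ => by ring) measurableSet_Ioo
  have i2 : IntegrableOn (fun x => v x * z x * deriv ψ x) (Ioo a b) :=
    (H.integrableOn_mul ((Hz.cont.mul
      (hψ.continuous_deriv (by simp)).continuousOn).integrableOn_Icc.mono_set
      Ioo_subset_Icc_self)).congr_fun (fun x _ => by simp only [Pi.mul_apply]; ring)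
      measurableSet_Ioo
  have e : ∫ x in Ioo a b, v x * (g x * ψ x + z x * deriv ψ x)
      = ∫ x in Ioo a b, (g x * v x * ψ x + v x * z x * deriv ψ x) := by
    congr 1 with x; ring
  rw [e, integral_add i1 i2] at h
  linarith

lemma pairingEqVar (hab : a < b) (H : IsOriented a b z v A B) (Hz : IsPrimitive a b z g)
    (hg : Measurable g) :
    PairingEqVar (Ioo a b) z (RadonMeasure.ofDensity measurableSet_Ioo Hz.int) v H.grad := by
  refine ⟨meanLim A B, H.isPreciseRep, H.locallyIntegrableOn_meanLim hg Hz.int, fun φ hφ => ?_⟩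
  have hc := hφ.smooth.continuous.continuousOn (s := Icc a b)
  have h := H.green hab Hz hφ.smooth
  rw [hφ.eq_zero (x := a) (by simp), hφ.eq_zero (x := b) (by simp)] at h
  rw [pairing, H.integral_meanLim_mul hg Hz.int hc]
  change _ = ∫ x, φ x ∂(monoDeriv a b H.pos + monoDeriv a b H.neg)
  rw [integral_add_measure (integrable_monoDeriv _ hc) (integrable_monoDeriv _ hc)]
  linarith

lemma hasNormalTrace (hab : a < b) (H : IsOriented a b z v A B) (Hz : IsPrimitive a b z g)
    (hg : Measurable g) :
    HasNormalTrace a b (fun x => v x * z x)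
      (-((Function.rightLim A a - Function.rightLim B a) * z a))
      ((Function.leftLim A b - Function.leftLim B b) * z b) := by
  -- The density is written with `A - B` instead of `v`, which is constrained only on `]a,b[` and
  -- need not be measurable on the line.
  have hk : Measurable fun x => (A x - B x) * g x := by
    have := H.pos.measurable; have := H.neg.measurable; fun_prop
  have hki : IntegrableOn (fun x => (A x - B x) * g x) (Ioo a b) :=
    (H.integrableOn_mul Hz.int).congr_fun (fun x hx => by simp [H.eq x hx]) measurableSet_Ioo
  have := isFiniteMeasure_posDensity hki
  have : IsFiniteMeasure (posDensity (Ioo a b) fun x => -((A x - B x) * g x)) :=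
    isFiniteMeasure_posDensity hki.neg
  -- The negative part of `g v dx` may overlap `|Dv|`, so the derivative of `vz` is built as a
  -- difference, which `ofSub` reduces to its Jordan decomposition.
  have green : ∀ ψ : ℝ → ℝ, ContDiff ℝ ∞ ψ →
      (RadonMeasure.ofSub (Ω := Ioo a b)
        (monoDeriv a b H.pos + monoDeriv a b H.neg
          + posDensity (Ioo a b) fun x => (A x - B x) * g x)
        (posDensity (Ioo a b) fun x => -((A x - B x) * g x))
        (by simp [monoDeriv_compl, posDensity_compl measurableSet_Ioo])
        (posDensity_compl measurableSet_Ioo _)).integral ψ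
        + ∫ x in Ioo a b, v x * z x * deriv ψ x
      = (Function.leftLim A b - Function.leftLim B b) * z b * ψ b
        + -((Function.rightLim A a - Function.rightLim B a) * z a) * ψ a := by
    intro ψ hψ
    have hc := hψ.continuous.continuousOn (s := Icc a b)
    have hF := integrableOn_mul_of_continuousOn hki hc
    have hm : AEStronglyMeasurable ψ (volume.restrict (Ioo a b)) :=
      hψ.continuous.aestronglyMeasurable
    have j1 := (integrable_monoDeriv H.pos hc)
    have j2 := (integrable_monoDeriv H.neg hc)
    have j3 := integrable_posDensity hk hF hm
    rw [RadonMeasure.ofSub_integral ((j1.add_measure j2).add_measure j3)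
      (integrable_posDensity_neg hk hF hm), integral_add_measure (j1.add_measure j2) j3,
      integral_add_measure j1 j2, add_sub_assoc, integral_posDensity_sub hk hF hm]
    have h := H.green hab Hz hψ
    have e : ∫ x in Ioo a b, (A x - B x) * g x * ψ x = ∫ x in Ioo a b, g x * v x * ψ x :=
      setIntegral_congr_fun measurableSet_Ioo fun x hx => by simp only [H.eq x hx]; ring
    rw [e]
    linarith
  refine ⟨_, ⟨⟨?_, fun φ hφ => ?_⟩, RadonMeasure.ofSub_finite⟩, green⟩
  · obtain ⟨C, hC⟩ := H.bound
    obtain ⟨D, hD⟩ := isCompact_Icc.exists_bound_of_continuousOn Hz.cont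
    refine memLp_top_of_bound (H.integrableOn.aestronglyMeasurable.mul
      ((Hz.cont.mono Ioo_subset_Icc_self).aestronglyMeasurable measurableSet_Ioo)) (C * D) ?_
    filter_upwards [ae_restrict_mem measurableSet_Ioo] with x hx
    rw [norm_mul]
    have := hC x hx
    exact mul_le_mul this (hD x (Ioo_subset_Icc_self hx)) (norm_nonneg _)
      ((abs_nonneg _).trans this)
  · have h := green φ hφ.smooth
    rw [hφ.eq_zero (x := a) (by simp), hφ.eq_zero (x := b) (by simp)] at h
    linarith

end IsOriented

/-! ### A criterion for weak solutions -/

section criterion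

variable {a b : ℝ} {z g f u A B A' B' : ℝ → ℝ}

/-- If `z` is a primitive of `g`, `u` and `χ_{u>0}` are oriented by `z` and
`f / u = -g χ_{u>0}` a.e., then `u` is a weak solution with `z`, provided that `u` is attained at
the boundary or `z` is the inner normal there. -/
theorem isWeakSolutionWith_of_isOriented (hab : a < b) (Hz : IsPrimitive a b z g)
    (hg : Measurable g) (hz : ∀ x ∈ Ioo a b, |z x| ≤ 1) (hu : ∀ x ∈ Ioo a b, 0 ≤ u x)
    (H : IsOriented a b z u A B) (H' : IsOriented a b z (posInd u) A' B')
    (hf : ∀ᵐ x ∂volume.restrict (Ioo a b), 0 ≤ -g x * posInd u x ∧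
      singTerm 1 f u x = ENNReal.ofReal (-g x * posInd u x))
    (ha : z a = 1 ∨ ∀ᶠ x in 𝓝[>] a, u x = 0) (hb : z b = -1 ∨ ∀ᶠ x in 𝓝[<] b, u x = 0) :
    IsWeakSolutionWith a b 1 f u z := by
  have hzb : ∀ᵐ x ∂volume.restrict (Ioo a b), ‖z x‖ ≤ 1 :=
    (ae_restrict_iff' measurableSet_Ioo).2 (Eventually.of_forall hz)
  have ha' := H.tendsto_right (left_mem_Ico.2 hab)
  have hb' := H.tendsto_left (right_mem_Ioc.2 hab)
  refine ⟨H.memLp_top, (ae_restrict_iff' measurableSet_Ioo).2 (Eventually.of_forall hu), ?_,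
    H.grad, H'.grad, RadonMeasure.ofDensity measurableSet_Ioo Hz.int,
    ⟨H.integrableOn, H.hasDeriv hab, H.grad_finite⟩,
    ⟨H'.integrableOn.locallyIntegrableOn, H'.hasDeriv hab⟩,
    ⟨memLp_top_of_bound ((Hz.cont.mono Ioo_subset_Icc_self).aestronglyMeasurable
      measurableSet_Ioo) 1 hzb, Hz.hasDeriv hab.le hg⟩, ?_,
    ⟨meanLim A' B', H'.isPreciseRep, H'.locallyIntegrableOn_meanLim hg Hz.int, ?_⟩,
    H.pairingEqVar hab Hz hg, H'.pairingEqVar hab Hz hg, _, _, _, _,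
    .of_tendsto ha', .of_tendsto hb', H.hasNormalTrace hab Hz hg, ?_, ?_⟩
  · simpa using eLpNormEssSup_le_of_ae_bound hzb
  · intro K _ hK
    calc ∫⁻ x in K, singTerm 1 f u x ≤ ∫⁻ x in Ioo a b, singTerm 1 f u x :=
          lintegral_mono_set hK
      _ ≤ ∫⁻ x in Ioo a b, ‖g x‖ₑ := by
          refine lintegral_mono_ae ?_
          filter_upwards [hf] with x hx
          rw [hx.2, ← ofReal_norm]
          refine ENNReal.ofReal_le_ofReal ((le_abs_self _).trans ?_)
          rw [abs_mul, abs_neg, Real.norm_eq_abs]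
          refine mul_le_of_le_one_right (abs_nonneg _) ?_
          by_cases hx : 0 < u x <;> simp [posInd, hx]
      _ < ⊤ := Hz.int.2
  · intro φ hφ
    rw [H'.integral_meanLim_mul hg Hz.int hφ.smooth.continuous.continuousOn, ← integral_neg]
    refine integral_congr_ae ?_
    filter_upwards [hf] with x hx
    rw [hx.2, ENNReal.toReal_ofReal hx.1]
    ring
  -- With trace `t` of `u` at `a`, the condition is `t (1 - z a) = 0`.
  · rcases ha with h | h
    · rw [h]; ring
    · rw [tendsto_nhds_unique ha' (tendsto_const_nhds.congr' (EventuallyEq.symm h))]; ring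
  -- With trace `t` of `u` at `b`, the condition is `t (1 + z b) = 0`.
  · rcases hb with h | h
    · rw [h]; ring
    · rw [tendsto_nhds_unique hb' (tendsto_const_nhds.congr' (EventuallyEq.symm h))]; ring

lemma derivCarried_of_isOriented (hab : a < b) (Hz : IsPrimitive a b z g)
    (hg : Measurable g) (H' : IsOriented a b z (posInd u) A' B')
    (hc : ∀ᵐ x ∂volume.restrict (Ioo a b), g x * posInd u x = g x) :
    DerivCarried (Ioo a b) z u := by
  refine ⟨RadonMeasure.ofDensity measurableSet_Ioo Hz.int, meanLim A' B', Hz.hasDeriv hab.le hg,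
    H'.isPreciseRep, H'.locallyIntegrableOn_meanLim hg Hz.int, fun φ hφ => ?_⟩
  have hφc := hφ.smooth.continuous.continuousOn (s := Icc a b)
  rw [H'.integral_meanLim_mul hg Hz.int hφc, RadonMeasure.ofDensity_integral hg
    (integrableOn_mul_of_continuousOn Hz.int hφc) hφ.smooth.continuous.aestronglyMeasurable]
  refine integral_congr_ae ?_
  filter_upwards [hc] with x hx
  rw [hx]

/-- If `z' = k ≠ 0` on an interval where `u` vanishes, then `z' ≠ z' χ*_{u>0}`. -/
lemma not_derivCarried {c r k : ℝ} (hab : a ≤ b) (hr : 0 < r) (hk : k ≠ 0)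
    (Hz : IsPrimitive a b z g) (hsub : Ioo (c - r) (c + r) ⊆ Ioo a b)
    (hgk : ∀ x ∈ Ioo (c - r) (c + r), g x = k) (hu : ∀ x ∈ Ioo (c - r) (c + r), u x = 0) :
    ¬ DerivCarried (Ioo a b) z u := by
  rintro ⟨μ, w, hμ, hw, -, h⟩
  let φ : ContDiffBump c := ⟨r / 4, r / 2, by positivity, by linarith⟩
  have hts : tsupport φ ⊆ Ioo (c - r) (c + r) := by
    rw [φ.tsupport_eq, Real.closedBall_eq_Icc]
    exact Icc_subset_Ioo (by change c - r < c - r / 2; linarith)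
      (by change c + r / 2 < c + r; linarith)
  have hφ : IsTest (Ioo a b) φ := ⟨φ.contDiff, φ.hasCompactSupport, hts.trans hsub⟩
  have hφ0 : ∀ x ∉ Ioo (c - r) (c + r), φ x = 0 := fun x hx =>
    image_eq_zero_of_notMem_tsupport fun h => hx (hts h)
  -- Any precise representative vanishes on the open interval where `u` does, so the argument covers
  -- every choice of `w`.
  have h0 : (fun x => w x * φ x) = fun _ => 0 := by
    ext x
    by_cases hx : x ∈ Ioo (c - r) (c + r)
    · have : w x = 0 := (hw x (hsub hx)).eq_zero_of_eventually
        (r := min (x - (c - r)) (c + r - x)) (lt_min (by linarith [hx.1]) (by linarith [hx.2]))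
        fun y hy => by
          have h1 := min_le_left (x - (c - r)) (c + r - x)
          have h2 := min_le_right (x - (c - r)) (c + r - x)
          simp [posInd, hu y ⟨by linarith [hy.1], by linarith [hy.2]⟩]
      simp [this]
    · simp [hφ0 x hx]
  -- The value of `μ` on `φ` is determined by `z` whatever `μ` was chosen: it is `k ∫ φ ≠ 0`,
  -- against `0` from the carried side.
  have h1 := hμ φ hφ
  rw [h φ hφ, h0, Hz.integral_mul_deriv hab hφ] at h1
  have h2 : ∫ x in Ioo a b, g x * φ x = ∫ x in Ioo a b, k * φ x :=
    setIntegral_congr_fun measurableSet_Ioo fun x _ => by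
      by_cases hx : x ∈ Ioo (c - r) (c + r)
      · simp [hgk x hx]
      · simp [hφ0 x hx]
  rw [h2, integral_const_mul, setIntegral_eq_integral_of_forall_compl_eq_zero
    (fun x hx => hφ.eq_zero hx)] at h1
  simp [RadonMeasure.integral, hk, φ.integral_pos.ne'] at h1

end criterion

/-! ### Piecewise smooth fields -/

/-- `h` is continuous and has the derivative `h'` off a countable set, where `h'` is measurable and
bounded on `]a,b[`. -/
structure IsPiecewiseSmooth (a b : ℝ) (h h' : ℝ → ℝ) : Prop where
  cont : Continuous h
  meas : Measurable h'
  bdd : ∃ C, ∀ x ∈ Ioo a b, |h' x| ≤ C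
  deriv : ∃ s : Set ℝ, s.Countable ∧ ∀ x ∉ s, HasDerivAt h (h' x) x

namespace IsPiecewiseSmooth

variable {a b c : ℝ} {h h' p p' q q' : ℝ → ℝ}

lemma isPrimitive (H : IsPiecewiseSmooth a b h h') : IsPrimitive a b h h' where
  cont := H.cont.continuousOn
  int := by
    obtain ⟨C, hC⟩ := H.bdd
    exact Measure.integrableOn_of_bounded (M := C) (by simp) H.meas.aestronglyMeasurable
      ((ae_restrict_iff' measurableSet_Ioo).2 (Eventually.of_forall hC))
  deriv := by
    obtain ⟨s, hs, hd⟩ := H.deriv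
    exact ⟨s, hs, fun x hx => hd x hx.2⟩

lemma of_hasDerivAt (hd : ∀ x, HasDerivAt p (p' x) x) (hc : Continuous p') :
    IsPiecewiseSmooth a b p p' where
  cont := continuous_iff_continuousAt.2 fun x => (hd x).continuousAt
  meas := hc.measurable
  bdd := by
    obtain ⟨C, hC⟩ := isCompact_Icc.exists_bound_of_continuousOn (hc.continuousOn (s := Icc a b))
    exact ⟨C, fun x hx => hC x (Ioo_subset_Icc_self hx)⟩
  deriv := ⟨∅, countable_empty, fun x _ => hd x⟩

/-- The branches agree at `c`, so it does not matter on which side `P` puts `c`; this covers both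
strict and weak inequalities. -/
lemma ite (Hp : IsPiecewiseSmooth a b p p') (Hq : IsPiecewiseSmooth a b q q') (hpq : p c = q c)
    {P : ℝ → Prop} [DecidablePred P] (hlt : ∀ x < c, P x) (hgt : ∀ x > c, ¬ P x) :
    IsPiecewiseSmooth a b (fun x => if P x then p x else q x)
      (fun x => if P x then p' x else q' x) where
  cont := by
    have : (fun x => if P x then p x else q x) = fun x => if x ≤ c then p x else q x := by
      ext x
      rcases lt_trichotomy x c with h | rfl | h
      · simp [hlt x h, h.le]
      · simp [hpq]
      · simp [hgt x h, h.not_ge]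
    rw [this]
    exact Continuous.if_le Hp.cont Hq.cont continuous_id continuous_const fun x hx => by
      rw [show x = c from hx, hpq]
  meas := by
    have hP : MeasurableSet {x | P x} := by
      refine (Set.OrdConnected.measurableSet (s := {x | P x}) ⟨fun x hx y hy t ht => ?_⟩)
      rcases lt_trichotomy t c with h | rfl | h
      · exact hlt t h
      · rcases ht.2.lt_or_eq with h | h
        · exact absurd hy (hgt y h)
        · exact h ▸ hy
      · exact absurd hy (hgt y (h.trans_le ht.2))
    exact Measurable.ite hP Hp.meas Hq.meas
  bdd := by
    obtain ⟨C, hC⟩ := Hp.bdd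
    obtain ⟨D, hD⟩ := Hq.bdd
    refine ⟨max C D, fun x hx => ?_⟩
    split_ifs
    · exact (hC x hx).trans (le_max_left _ _)
    · exact (hD x hx).trans (le_max_right _ _)
  deriv := by
    obtain ⟨s, hs, hsd⟩ := Hp.deriv
    obtain ⟨t, ht, htd⟩ := Hq.deriv
    refine ⟨insert c (s ∪ t), (hs.union ht).insert c, fun x hx => ?_⟩
    simp only [mem_insert_iff, mem_union, not_or] at hx
    rcases lt_or_gt_of_ne hx.1 with h | h
    · rw [if_pos (hlt x h)]
      refine (hsd x hx.2.1).congr_of_eventuallyEq ?_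
      filter_upwards [Iio_mem_nhds h] with y hy
      rw [if_pos (hlt y hy)]
    · rw [if_neg (hgt x h)]
      refine (htd x hx.2.2).congr_of_eventuallyEq ?_
      filter_upwards [Ioi_mem_nhds h] with y hy
      rw [if_neg (hgt y hy)]

lemma ite_of_gt (Hp : IsPiecewiseSmooth a b p p') (Hq : IsPiecewiseSmooth a b q q')
    (hpq : p c = q c) {P : ℝ → Prop} [DecidablePred P] (hlt : ∀ x < c, ¬ P x)
    (hgt : ∀ x > c, P x) :
    IsPiecewiseSmooth a b (fun x => if P x then p x else q x)
      (fun x => if P x then p' x else q' x) := by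
  simpa only [ite_not] using
    Hq.ite Hp hpq.symm (P := fun x => ¬ P x) hlt fun x hx => not_not.2 (hgt x hx)

lemma const (k : ℝ) : IsPiecewiseSmooth a b (fun _ => k) (fun _ => 0) :=
  of_hasDerivAt (fun x => hasDerivAt_const x k) continuous_const

lemma linear (k : ℝ) : IsPiecewiseSmooth a b (fun x => k * x) (fun _ => k) :=
  of_hasDerivAt (fun x => by simpa using (hasDerivAt_id x).const_mul k) continuous_const

lemma affine (k l : ℝ) : IsPiecewiseSmooth a b (fun x => k * (x + l)) (fun _ => k) :=
  of_hasDerivAt (fun x => by simpa using ((hasDerivAt_id x).add_const l).const_mul k)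
    continuous_const

lemma quadratic (k l m : ℝ) :
    IsPiecewiseSmooth a b (fun x => k * x ^ 2 + l * x + m) (fun x => 2 * k * x + l) :=
  of_hasDerivAt (fun x => by
    refine (((hasDerivAt_pow 2 x).const_mul k).add
      ((hasDerivAt_id x).const_mul l)).add_const m |>.congr_deriv ?_
    simp; ring) (by fun_prop)

end IsPiecewiseSmooth

/-! ### Step functions and unimodal functions -/

/-- The two derivatives charge at most the points `p` and `q`, so the field matters only there. No
order between `p` and `q` is imposed: `p < q` gives a bump, `q < p` a gap, and `c = 0` a constant.
-/
lemma isOriented_step {a b p q d c : ℝ} {z v : ℝ → ℝ} (hc : 0 ≤ c) (hp : z p = 1)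
    (hq : z q = -1)
    (hv : ∀ x ∈ Ioo a b, v x = (if x ≤ p then d else d + c) - (if x < q then 0 else c)) :
    IsOriented a b z v (fun x => if x ≤ p then d else d + c) (fun x => if x < q then 0 else c) := by
  have mA : Monotone fun x => if x ≤ p then d else d + c := by
    intro x y hxy
    dsimp only
    split_ifs <;> linarith
  have mB : Monotone fun x => if x < q then 0 else c := by
    intro x y hxy
    dsimp only
    split_ifs <;> linarith
  refine ⟨mA, mB, hv, ?_, ?_⟩
  · have h1 := monoDeriv_eq_zero_of_const (a := a) (b := b) mA (p := a) (q := p) (c := d)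
      fun x hx => if_pos hx.2.le
    have h2 := monoDeriv_eq_zero_of_const (a := a) (b := b) mA (p := p) (q := b) (c := d + c)
      fun x hx => if_neg hx.1.not_ge
    filter_upwards [compl_mem_ae_iff.2 h1, compl_mem_ae_iff.2 h2,
      compl_mem_ae_iff.2 (monoDeriv_compl mA)] with x hx1 hx2 hx3
    have hx : x ∈ Ioo a b := not_not.1 hx3
    rw [← hp]
    rcases lt_trichotomy x p with h | rfl | h
    · exact absurd ⟨hx.1, h⟩ hx1
    · rfl
    · exact absurd ⟨h, hx.2⟩ hx2
  · have h1 := monoDeriv_eq_zero_of_const (a := a) (b := b) mB (p := a) (q := q) (c := 0)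
      fun x hx => if_pos hx.2
    have h2 := monoDeriv_eq_zero_of_const (a := a) (b := b) mB (p := q) (q := b) (c := c)
      fun x hx => if_neg hx.1.not_gt
    filter_upwards [compl_mem_ae_iff.2 h1, compl_mem_ae_iff.2 h2,
      compl_mem_ae_iff.2 (monoDeriv_compl mB)] with x hx1 hx2 hx3
    have hx : x ∈ Ioo a b := not_not.1 hx3
    rw [← hq]
    rcases lt_trichotomy x q with h | rfl | h
    · exact absurd ⟨hx.1, h⟩ hx1
    · rfl
    · exact absurd ⟨h, hx.2⟩ hx2

/-- `A` carries the rise of `v` and `B` its fall. Both are frozen outside `]a,b[`, since they must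
be monotone on the whole line while `v` is controlled only inside; the jumps this creates at `a` and
`b` are not charged. -/
lemma isOriented_unimodal {a b p q c : ℝ} {z v : ℝ → ℝ} (hpq : p < q)
    (hc : 0 ≤ c) (hv : ∀ x ∈ Ioo a b, 0 ≤ v x ∧ v x ≤ c) (hp : MonotoneOn v (Ioc a p))
    (hpqv : ∀ x ∈ Ioo p q, v x = c) (hq : AntitoneOn v (Ico q b))
    (hz1 : ∀ x ∈ Ioc a p, z x = 1) (hz2 : ∀ x ∈ Ico q b, z x = -1) (hap : p < b) (hqb : a < q) :
    IsOriented a b z v (fun x => if x ≤ a then 0 else if x ≤ p then v x else c)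
      (fun x => if x < q then 0 else if x < b then c - v x else c) := by
  have mA : Monotone fun x => if x ≤ a then 0 else if x ≤ p then v x else c := by
    intro x y hxy
    dsimp only
    split_ifs with h1 h2 h3 h4 h5 h6 <;> try linarith
    · exact (hv y ⟨not_le.1 h2, h3.trans_lt hap⟩).1
    · exact hp ⟨not_le.1 h1, h4⟩ ⟨not_le.1 h5, h6⟩ hxy
    · exact (hv x ⟨not_le.1 h1, h4.trans_lt hap⟩).2
  have mB : Monotone fun x => if x < q then 0 else if x < b then c - v x else c := by
    intro x y hxy
    dsimp only
    split_ifs with h1 h2 h3 h4 h5 h6 <;> try linarith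
    · linarith [(hv y ⟨hqb.trans_le (not_lt.1 h2), h3⟩).2]
    · linarith [hq ⟨not_lt.1 h1, h4⟩ ⟨not_lt.1 h5, h6⟩ hxy]
    · linarith [(hv x ⟨hqb.trans_le (not_lt.1 h1), h4⟩).1]
  refine ⟨mA, mB, fun x hx => ?_, ?_, ?_⟩
  · rw [if_neg hx.1.not_ge, if_pos hx.2]
    split_ifs with h1 h2 h2
    · ring
    · exact absurd (h1.trans_lt hpq) h2
    · rw [hpqv x ⟨not_le.1 h1, h2⟩]; ring
    · ring
  -- The maximum accounts for the possibility `p ≤ a`.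
  · have h1 := monoDeriv_eq_zero_of_const (a := a) (b := b) mA (p := max a p) (q := b) (c := c)
      fun x hx => by
        have := max_lt_iff.1 hx.1
        rw [if_neg this.1.not_ge, if_neg this.2.not_ge]
    filter_upwards [compl_mem_ae_iff.2 h1, compl_mem_ae_iff.2 (monoDeriv_compl mA)] with x hx1 hx3
    have hx : x ∈ Ioo a b := not_not.1 hx3
    exact hz1 x ⟨hx.1, not_lt.1 fun h => hx1 ⟨max_lt hx.1 h, hx.2⟩⟩
  · have h1 := monoDeriv_eq_zero_of_const (a := a) (b := b) mB (p := a) (q := q) (c := 0)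
      fun x hx => if_pos hx.2
    filter_upwards [compl_mem_ae_iff.2 h1, compl_mem_ae_iff.2 (monoDeriv_compl mB)] with x hx1 hx3
    have hx : x ∈ Ioo a b := not_not.1 hx3
    exact hz2 x ⟨not_lt.1 fun h => hx1 ⟨hx.1, h⟩, hx.2⟩

/-! ### Auxiliary facts for the examples -/

lemma singTerm_of_pos {f u : ℝ → ℝ} {x : ℝ} (hu : 0 < u x) :
    singTerm 1 f u x = ENNReal.ofReal (f x / u x) := by
  rw [singTerm, Real.rpow_one, ENNReal.ofReal_div_of_pos hu]

lemma singTerm_of_eq_zero {γ : ℝ} {f u : ℝ → ℝ} {x : ℝ} (hf : f x = 0) :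
    singTerm γ f u x = 0 := by
  simp [singTerm, hf]

lemma posInd_of_pos {u : ℝ → ℝ} {x : ℝ} (hu : 0 < u x) : posInd u x = 1 :=
  indicator_of_mem (s := {x | 0 < u x}) hu _

lemma posInd_of_eq_zero {u : ℝ → ℝ} {x : ℝ} (hu : u x = 0) : posInd u x = 0 :=
  indicator_of_notMem (s := {x | 0 < u x}) (by simp [hu]) _

lemma posInd_indicator_const (S : Set ℝ) {c : ℝ} (hc : 0 < c) :
    posInd (S.indicator fun _ => c) = S.indicator fun _ => 1 := by
  ext x
  by_cases hx : x ∈ S <;> simp [posInd, indicator, hx, hc]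

lemma different_of_ne_on_Ioo {u v : ℝ → ℝ} {p q : ℝ} (hpq : p < q)
    (hsub : Ioo p q ⊆ Ioo (-1) 1) (h : ∀ x ∈ Ioo p q, u x ≠ v x) : Different u v := by
  intro he
  have h1 : ∀ᵐ x ∂volume.restrict (Ioo p q), u x = v x :=
    ae_mono (Measure.restrict_mono hsub le_rfl) he
  rw [ae_restrict_iff' measurableSet_Ioo, ae_iff] at h1
  have h2 : volume (Ioo p q) = 0 := measure_mono_null (fun x hx => (fun he => h x hx (he hx) :
    ¬ (x ∈ Ioo p q → u x = v x))) h1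
  rw [Real.volume_Ioo, ENNReal.ofReal_eq_zero] at h2
  linarith

lemma volume_zeros_pos {f : ℝ → ℝ} {p q : ℝ} (hpq : p < q) (hsub : Ioo p q ⊆ Ioo (-1) 1)
    (h : ∀ x ∈ Ioo p q, f x = 0) : 0 < volume {x ∈ Ioo (-1 : ℝ) 1 | f x = 0} :=
  lt_of_lt_of_le (by simpa using hpq)
    (measure_mono (μ := volume) fun x hx => (⟨hsub hx, h x hx⟩ : x ∈ Ioo (-1 : ℝ) 1 ∧ f x = 0))

/-! ### First example -/

/-- The derivative of `z₁₁`. -/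
def dz₁₁ (x : ℝ) : ℝ := if x < -1/2 then 0 else if x ≤ 1/2 then -2 else 0

/-- The derivative of `z₁₂`. -/
def dz₁₂ (x : ℝ) : ℝ := if x < -1/2 then 2 else if x ≤ 1/2 then -2 else 2

lemma z₁₁_smooth : IsPiecewiseSmooth (-1) 1 z₁₁ dz₁₁ :=
  .ite (c := -1/2) (.const 1) (.ite (c := 1/2) (.linear (-2)) (.const (-1)) (by norm_num)
    (fun _ h => le_of_lt h) (fun _ h => not_le.2 h)) (by norm_num) (fun _ h => h)
    (fun _ h => not_lt.2 (le_of_lt h))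

lemma z₁₂_smooth : IsPiecewiseSmooth (-1) 1 z₁₂ dz₁₂ :=
  .ite (c := -1/2) (.affine 2 1) (.ite (c := 1/2) (.linear (-2)) (.affine 2 (-1)) (by norm_num)
    (fun _ h => le_of_lt h) (fun _ h => not_le.2 h)) (by norm_num) (fun _ h => h)
    (fun _ h => not_lt.2 (le_of_lt h))

lemma abs_z₁₁_le {x : ℝ} : |z₁₁ x| ≤ 1 := by
  rw [abs_le, z₁₁]
  split_ifs <;> constructor <;> linarith

lemma abs_z₁₂_le {x : ℝ} (hx : x ∈ Ioo (-1) 1) : |z₁₂ x| ≤ 1 := by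
  obtain ⟨h1, h2⟩ := hx
  rw [abs_le, z₁₂]
  split_ifs <;> constructor <;> linarith

lemma z₁₁_eq_one {x : ℝ} (hx : x ≤ -1/2) : z₁₁ x = 1 := by
  rw [z₁₁]
  split_ifs <;> linarith

lemma z₁₁_eq_neg_one {x : ℝ} (hx : 1/2 ≤ x) : z₁₁ x = -1 := by
  rw [z₁₁]
  split_ifs <;> linarith

lemma isDatum_f₁ : IsDatum (-1) 1 f₁ :=
  ⟨(integrableOn_const (C := (1 : ℝ)) (by simp)).indicator measurableSet_Ioo,
    Eventually.of_forall fun _ => indicator_nonneg (fun _ _ => zero_le_one) _⟩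

lemma f₁_of_mem {x : ℝ} (hx : x ∈ Ioo (-1/2 : ℝ) (1/2)) : f₁ x = 1 := indicator_of_mem hx _

lemma f₁_of_notMem {x : ℝ} (hx : x ∉ Ioo (-1/2 : ℝ) (1/2)) : f₁ x = 0 := indicator_of_notMem hx _

lemma ae_ne_half : ∀ᵐ x ∂volume.restrict (Ioo (-1 : ℝ) 1), x ≠ -1/2 ∧ x ≠ 1/2 := by
  filter_upwards [ae_restrict_of_ae ((countable_singleton (-1/2 : ℝ)).ae_notMem volume),
    ae_restrict_of_ae ((countable_singleton (1/2 : ℝ)).ae_notMem volume)] with x h1 h2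
    using ⟨h1, h2⟩

lemma dz₁₁_eq_zero {x : ℝ} (hx : x ≠ -1/2 ∧ x ≠ 1/2) (h : x ∉ Ioo (-1/2 : ℝ) (1/2)) :
    dz₁₁ x = 0 := by
  rw [dz₁₁]
  split_ifs with h1 h2
  · rfl
  · exact absurd ⟨lt_of_le_of_ne (not_lt.1 h1) hx.1.symm, lt_of_le_of_ne h2 hx.2⟩ h
  · rfl

lemma isOriented_z₁₁ {c : ℝ} {v : ℝ → ℝ} (hc : 0 ≤ c)
    (hv : ∀ x ∈ Ioo (-1 : ℝ) 1, 0 ≤ v x ∧ v x ≤ c) (hp : MonotoneOn v (Ioc (-1) (-1/2)))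
    (hpq : ∀ x ∈ Ioo (-1/2 : ℝ) (1/2), v x = c) (hq : AntitoneOn v (Ico (1/2) 1)) :
    ∃ A B, IsOriented (-1) 1 z₁₁ v A B :=
  ⟨_, _, isOriented_unimodal (by norm_num) hc hv hp hpq hq (fun _ hx => z₁₁_eq_one hx.2)
    (fun _ hx => z₁₁_eq_neg_one hx.1) (by norm_num) (by norm_num)⟩

lemma posInd_mono {u : ℝ → ℝ} {x y : ℝ} (h : u x ≤ u y) : posInd u x ≤ posInd u y := by
  by_cases hx : 0 < u x
  · rw [posInd_of_pos hx, posInd_of_pos (hx.trans_le h)]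
  · rw [posInd, indicator_of_notMem (by simpa using hx)]
    exact indicator_nonneg (fun _ _ => zero_le_one) _

theorem isWeakSolutionWith_z₁₁ {u : ℝ → ℝ} (hu : ∀ x ∈ Ioo (-1 : ℝ) 1, 0 ≤ u x ∧ u x ≤ 1/2)
    (hp : MonotoneOn u (Ioc (-1) (-1/2))) (hpq : ∀ x ∈ Ioo (-1/2 : ℝ) (1/2), u x = 1/2)
    (hq : AntitoneOn u (Ico (1/2) 1)) : IsWeakSolutionWith (-1) 1 1 f₁ u z₁₁ := by
  obtain ⟨A, B, H⟩ := isOriented_z₁₁ (by norm_num) hu hp hpq hq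
  -- The indicator of `{u > 0}` is a nondecreasing function of `u`, hence unimodal too, with top
  -- value `1`.
  obtain ⟨A', B', H'⟩ := isOriented_z₁₁ (v := posInd u) zero_le_one
    (fun x _ => ⟨indicator_nonneg (fun _ _ => zero_le_one) _,
      indicator_le_self' (fun _ _ => zero_le_one) _⟩)
    (fun x hx y hy hxy => posInd_mono (hp hx hy hxy))
    (fun x hx => posInd_of_pos (by rw [hpq x hx]; norm_num))
    (fun x hx y hy hxy => posInd_mono (hq hx hy hxy))
  refine isWeakSolutionWith_of_isOriented (by norm_num) z₁₁_smooth.isPrimitive z₁₁_smooth.meas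
    (fun x _ => abs_z₁₁_le) (fun x hx => (hu x hx).1) H H' ?_
    (Or.inl (z₁₁_eq_one (by norm_num))) (Or.inl (z₁₁_eq_neg_one (by norm_num)))
  -- At `±1/2` the identity can fail: there `f₁ = 0` and `dz₁₁ = -2`, while `u` may be positive.
  filter_upwards [ae_ne_half] with x hx
  by_cases h : x ∈ Ioo (-1/2 : ℝ) (1/2)
  · have hux : 0 < u x := by rw [hpq x h]; norm_num
    rw [posInd_of_pos hux, singTerm_of_pos hux, f₁_of_mem h, hpq x h, dz₁₁, if_neg h.1.not_gt,
      if_pos h.2.le]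
    norm_num
  · rw [singTerm_of_eq_zero (f₁_of_notMem h), dz₁₁_eq_zero hx h]
    simp

theorem isWeakSolutionWith_u₁₁ : IsWeakSolutionWith (-1) 1 1 f₁ u₁₁ z₁₁ :=
  isWeakSolutionWith_z₁₁ (fun _ _ => ⟨by norm_num [u₁₁], le_rfl⟩) (fun _ _ _ _ _ => le_rfl)
    (fun _ _ => rfl) (fun _ _ _ _ _ => le_rfl)

lemma u₁₂_of_mem {x : ℝ} (hx : x ∈ Ioo (-1/2 : ℝ) (1/2)) : u₁₂ x = 1/2 := indicator_of_mem hx _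

lemma u₁₂_of_le {x : ℝ} (hx : x ≤ -1/2) : u₁₂ x = 0 :=
  indicator_of_notMem (fun h => h.1.not_ge hx) _

lemma u₁₂_of_ge {x : ℝ} (hx : 1/2 ≤ x) : u₁₂ x = 0 :=
  indicator_of_notMem (fun h => h.2.not_ge hx) _

lemma u₁₂_nonneg (x : ℝ) : 0 ≤ u₁₂ x := indicator_nonneg (fun _ _ => by norm_num) _

theorem isWeakSolutionWith_u₁₂ : IsWeakSolutionWith (-1) 1 1 f₁ u₁₂ z₁₁ :=
  isWeakSolutionWith_z₁₁
    (fun x _ => ⟨u₁₂_nonneg x, indicator_le_self' (fun _ _ => by norm_num) _⟩)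
    (fun x hx y hy _ => by rw [u₁₂_of_le hx.2, u₁₂_of_le hy.2]) (fun _ => u₁₂_of_mem)
    (fun x hx y hy _ => by rw [u₁₂_of_ge hx.1, u₁₂_of_ge hy.1])

lemma isOriented_indicator_f₁ {z : ℝ → ℝ} {c : ℝ} (hc : 0 ≤ c) (hp : z (-1/2) = 1)
    (hq : z (1/2) = -1) :
    IsOriented (-1) 1 z ((Ioo (-1/2 : ℝ) (1/2)).indicator fun _ => c)
      (fun x => if x ≤ -1/2 then 0 else 0 + c) (fun x => if x < 1/2 then 0 else c) := by
  refine isOriented_step hc hp hq fun x _ => ?_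
  rw [indicator]
  simp only [mem_Ioo]
  split_ifs <;> grind

lemma isOriented_posInd_u₁₂ {z : ℝ → ℝ} (hp : z (-1/2) = 1) (hq : z (1/2) = -1) :
    IsOriented (-1) 1 z (posInd u₁₂) (fun x => if x ≤ -1/2 then 0 else 0 + 1)
      (fun x => if x < 1/2 then 0 else 1) := by
  rw [u₁₂, posInd_indicator_const _ (by norm_num)]
  exact isOriented_indicator_f₁ zero_le_one hp hq

theorem isWeakSolutionWith_u₁₂_z₁₂ : IsWeakSolutionWith (-1) 1 1 f₁ u₁₂ z₁₂ := by
  have hp : z₁₂ (-1/2) = 1 := by norm_num [z₁₂]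
  have hq : z₁₂ (1/2) = -1 := by norm_num [z₁₂]
  -- Here `z₁₂` vanishes at `±1`, so the boundary condition rests on `u₁₂` vanishing near both
  -- endpoints.
  refine isWeakSolutionWith_of_isOriented (by norm_num) z₁₂_smooth.isPrimitive z₁₂_smooth.meas
    (fun x hx => abs_z₁₂_le hx) (fun x _ => u₁₂_nonneg x)
    (isOriented_indicator_f₁ (by norm_num) hp hq) (isOriented_posInd_u₁₂ hp hq) ?_ (Or.inr ?_)
    (Or.inr ?_)
  · refine Eventually.of_forall fun x => ?_
    by_cases h : x ∈ Ioo (-1/2 : ℝ) (1/2)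
    · have hux : 0 < u₁₂ x := by rw [u₁₂_of_mem h]; norm_num
      rw [posInd_of_pos hux, singTerm_of_pos hux, f₁_of_mem h, u₁₂_of_mem h, dz₁₂,
        if_neg h.1.not_gt, if_pos h.2.le]
      norm_num
    · rw [singTerm_of_eq_zero (f₁_of_notMem h), posInd_of_eq_zero (u := u₁₂)
        (indicator_of_notMem h _)]
      simp
  · filter_upwards [Ioo_mem_nhdsGT (show (-1 : ℝ) < -1/2 by norm_num)] with x hx
      using u₁₂_of_le hx.2.le
  · filter_upwards [Ioo_mem_nhdsLT (show (1/2 : ℝ) < 1 by norm_num)] with x hx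
      using u₁₂_of_ge hx.1.le

lemma derivCarried_z₁₁ : DerivCarried (Ioo (-1) 1) z₁₁ u₁₂ := by
  refine derivCarried_of_isOriented (by norm_num) z₁₁_smooth.isPrimitive z₁₁_smooth.meas
    (isOriented_posInd_u₁₂ (z₁₁_eq_one le_rfl) (z₁₁_eq_neg_one le_rfl)) ?_
  filter_upwards [ae_ne_half] with x hx
  by_cases h : x ∈ Ioo (-1/2 : ℝ) (1/2)
  · rw [posInd_of_pos (by rw [u₁₂_of_mem h]; norm_num), mul_one]
  · rw [dz₁₁_eq_zero hx h, zero_mul]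

lemma not_derivCarried_z₁₂ : ¬ DerivCarried (Ioo (-1) 1) z₁₂ u₁₂ := by
  -- The interval `]-7/8, -5/8[` lies where `u₁₂ = 0` and `z₁₂` has slope `2`.
  refine not_derivCarried (c := -3/4) (r := 1/8) (k := 2) (by norm_num) (by norm_num)
    (by norm_num) z₁₂_smooth.isPrimitive (fun x hx => ?_) (fun x hx => ?_) fun x hx => ?_
  · constructor <;> linarith [hx.1, hx.2]
  · exact if_pos (by linarith [hx.2])
  · exact u₁₂_of_le (by linarith [hx.2])

lemma different_u₁₁_u₁₂ : Different u₁₁ u₁₂ := by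
  refine different_of_ne_on_Ioo (p := 1/2) (q := 1) (by norm_num)
    (Ioo_subset_Ioo_left (by norm_num)) fun x hx => ?_
  rw [u₁₂_of_ge hx.1.le, u₁₁]
  norm_num

lemma different_z₁₁_z₁₂ : Different z₁₁ z₁₂ := by
  refine different_of_ne_on_Ioo (p := 1/2) (q := 1) (by norm_num)
    (Ioo_subset_Ioo_left (by norm_num)) fun x hx => ?_
  obtain ⟨h1, h2⟩ := hx
  rw [z₁₁_eq_neg_one h1.le, z₁₂, if_neg (by linarith), if_neg (by linarith)]
  intro h
  linarith

/-! ### Second example -/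

/-- The derivative of `z₂₁`. -/
def dz₂₁ (x : ℝ) : ℝ :=
  if 1/2 ≤ x then 2 * (-4) * x + 4 else if -1/2 < x then 0 else 2 * 4 * x + 4

/-- The derivative of `z₂₂`. -/
def dz₂₂ (x : ℝ) : ℝ :=
  if 1/2 ≤ x then 2 * (-8) * x + 8 else if -1/2 < x then 2 else 2 * 8 * x + 8

/-- The derivative of `z₂₃`. -/
def dz₂₃ (x : ℝ) : ℝ :=
  if 1/2 ≤ x then 2 * (-8) * x + 8
  else if 1/4 ≤ x then 0
  else if -1/4 < x then 4
  else if -1/2 < x then 0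
  else 2 * 8 * x + 8

lemma z₂₁_smooth : IsPiecewiseSmooth (-1) 1 z₂₁ dz₂₁ :=
  .ite_of_gt (c := 1/2) (.quadratic (-4) 4 (-1))
    (.ite_of_gt (c := -1/2) (.const 0) (.quadratic 4 4 1) (by norm_num)
      (fun _ h => not_lt.2 (le_of_lt h)) (fun _ h => h)) (by norm_num) (fun _ h => not_le.2 h)
    (fun _ h => le_of_lt h)

lemma z₂₂_smooth : IsPiecewiseSmooth (-1) 1 z₂₂ dz₂₂ :=
  .ite_of_gt (c := 1/2) (.quadratic (-8) 8 (-1))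
    (.ite_of_gt (c := -1/2) (.linear 2) (.quadratic 8 8 1) (by norm_num)
      (fun _ h => not_lt.2 (le_of_lt h)) (fun _ h => h)) (by norm_num) (fun _ h => not_le.2 h)
    (fun _ h => le_of_lt h)

lemma z₂₃_smooth : IsPiecewiseSmooth (-1) 1 z₂₃ dz₂₃ :=
  .ite_of_gt (c := 1/2) (.quadratic (-8) 8 (-1))
    (.ite_of_gt (c := 1/4) (.const 1)
      (.ite_of_gt (c := -1/4) (.linear 4)
        (.ite_of_gt (c := -1/2) (.const (-1)) (.quadratic 8 8 1) (by norm_num)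
          (fun _ h => not_lt.2 (le_of_lt h)) (fun _ h => h)) (by norm_num)
        (fun _ h => not_lt.2 (le_of_lt h)) (fun _ h => h)) (by norm_num) (fun _ h => not_le.2 h)
      (fun _ h => le_of_lt h)) (by norm_num) (fun _ h => not_le.2 h) (fun _ h => le_of_lt h)

lemma abs_z₂₁_le {x : ℝ} (hx : x ∈ Ioo (-1) 1) : |z₂₁ x| ≤ 1 := by
  obtain ⟨h1, h2⟩ := hx
  rw [abs_le, z₂₁]
  split_ifs <;> constructor <;> nlinarith

lemma abs_z₂₂_le {x : ℝ} (hx : x ∈ Ioo (-1) 1) : |z₂₂ x| ≤ 1 := by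
  obtain ⟨h1, h2⟩ := hx
  rw [abs_le, z₂₂]
  split_ifs <;> constructor <;> nlinarith

lemma abs_z₂₃_le {x : ℝ} (hx : x ∈ Ioo (-1) 1) : |z₂₃ x| ≤ 1 := by
  obtain ⟨h1, h2⟩ := hx
  rw [abs_le, z₂₃]
  split_ifs <;> constructor <;> nlinarith

lemma f₂_pos_iff {x : ℝ} : 0 < f₂ x ↔ x < -1/2 ∨ 1/2 < x := by
  rw [f₂]
  split_ifs with h1 h2
  · exact ⟨fun h => Or.inr (by linarith), fun h => by rcases h with h | h <;> linarith⟩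
  · exact ⟨fun h => absurd h (lt_irrefl _), fun h => by rcases h with h | h <;> linarith⟩
  · exact ⟨fun h => Or.inl (by linarith), fun h => by rcases h with h | h <;> linarith⟩

lemma f₂_nonneg (x : ℝ) : 0 ≤ f₂ x := by
  rw [f₂]
  split_ifs <;> linarith

lemma f₂_eq_zero {x : ℝ} (h1 : -1/2 ≤ x) (h2 : x ≤ 1/2) : f₂ x = 0 :=
  le_antisymm (not_lt.1 fun h => by rcases f₂_pos_iff.1 h with h | h <;> linarith) (f₂_nonneg x)

lemma isDatum_f₂ : IsDatum (-1) 1 f₂ := by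
  refine ⟨Measure.integrableOn_of_bounded (M := 1) (by simp) ?_ ?_, Eventually.of_forall f₂_nonneg⟩
  · refine Measurable.aestronglyMeasurable ?_
    exact Measurable.ite measurableSet_Ici (by fun_prop)
      (Measurable.ite measurableSet_Ioi (by fun_prop) (by fun_prop))
  · filter_upwards [ae_restrict_mem measurableSet_Ioo] with x hx
    obtain ⟨h1, h2⟩ := hx
    rw [Real.norm_of_nonneg (f₂_nonneg x), f₂]
    split_ifs <;> linarith

theorem isWeakSolutionWith_u₂₁ : IsWeakSolutionWith (-1) 1 1 f₂ u₂₁ z₂₁ := by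
  have hp : z₂₁ (-1) = 1 := by norm_num [z₂₁]
  have hq : z₂₁ 1 = -1 := by norm_num [z₂₁]
  have hpos : ∀ x, 0 < u₂₁ x := fun x => by norm_num [u₂₁]
  -- Constants are steps of height `0`; the endpoints serve only as points where `z₂₁` is `1` and
  -- `-1`.
  refine isWeakSolutionWith_of_isOriented (by norm_num) z₂₁_smooth.isPrimitive z₂₁_smooth.meas
    (fun x hx => abs_z₂₁_le hx) (fun x _ => (hpos x).le)
    (isOriented_step (d := 1/8) le_rfl hp hq fun x _ => by simp [u₂₁])
    (isOriented_step (d := 1) le_rfl hp hq fun x _ => by simp [posInd_of_pos (hpos x)])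
    (Eventually.of_forall fun x => ?_) (Or.inl hp) (Or.inl hq)
  have h : -dz₂₁ x * posInd u₂₁ x = f₂ x / u₂₁ x := by
    rw [posInd_of_pos (hpos x), dz₂₁, f₂, u₂₁]
    split_ifs <;> ring
  rw [singTerm_of_pos (hpos x), h]
  exact ⟨div_nonneg (f₂_nonneg x) (hpos x).le, rfl⟩

/-- The jump down at `-p` requires `z = -1` and the jump up at `p` requires `z = 1`, so the field
has to climb by `2` across the gap where `v` vanishes. -/
lemma isOriented_outer {z v : ℝ → ℝ} {c p : ℝ} (hc : 0 ≤ c) (hp0 : 0 < p) (hp : z p = 1)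
    (hq : z (-p) = -1)
    (hv0 : ∀ x ∈ Icc (-p) p, v x = 0) (hv1 : ∀ x ∈ Ioo (-1) (-p), v x = c)
    (hv2 : ∀ x ∈ Ioo p 1, v x = c) :
    IsOriented (-1) 1 z v (fun x => if x ≤ p then c else c + c)
      (fun x => if x < -p then 0 else c) := by
  refine isOriented_step hc hp hq fun x hx => ?_
  split_ifs with h1 h2 h2
  · rw [hv1 x ⟨hx.1, h2⟩, sub_zero]
  · rw [hv0 x ⟨not_lt.1 h2, h1⟩, sub_self]
  · linarith
  · rw [hv2 x ⟨not_le.1 h1, hx.2⟩]; ring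

lemma u₂₂_of_pos {x : ℝ} (hx : 0 < f₂ x) : u₂₂ x = 1/16 :=
  indicator_of_mem (s := {x | 0 < f₂ x}) hx _

lemma u₂₂_of_eq_zero {x : ℝ} (hx : f₂ x = 0) : u₂₂ x = 0 :=
  indicator_of_notMem (s := {x | 0 < f₂ x}) (by simp [hx]) _

theorem isWeakSolutionWith_u₂₂ : IsWeakSolutionWith (-1) 1 1 f₂ u₂₂ z₂₂ := by
  have hp : z₂₂ (1/2) = 1 := by norm_num [z₂₂]
  have hq : z₂₂ (-(1/2)) = -1 := by norm_num [z₂₂]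
  have h0 : ∀ x ∈ Icc (-(1/2) : ℝ) (1/2), u₂₂ x = 0 := fun x hx =>
    u₂₂_of_eq_zero (f₂_eq_zero (by linarith [hx.1]) hx.2)
  have h1 : ∀ x ∈ Ioo (-1 : ℝ) (-(1/2)), u₂₂ x = 1/16 := fun x hx =>
    u₂₂_of_pos (f₂_pos_iff.2 (Or.inl (by linarith [hx.2])))
  have h2 : ∀ x ∈ Ioo (1/2 : ℝ) 1, u₂₂ x = 1/16 := fun x hx =>
    u₂₂_of_pos (f₂_pos_iff.2 (Or.inr hx.1))
  refine isWeakSolutionWith_of_isOriented (by norm_num) z₂₂_smooth.isPrimitive z₂₂_smooth.meas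
    (fun x hx => abs_z₂₂_le hx) (fun x _ => indicator_nonneg (fun _ _ => by norm_num) _)
    (isOriented_outer (by norm_num) (by norm_num) hp hq h0 h1 h2)
    (isOriented_outer zero_le_one (by norm_num) hp hq (fun x hx => posInd_of_eq_zero (h0 x hx))
      (fun x hx => posInd_of_pos (by rw [h1 x hx]; norm_num))
      (fun x hx => posInd_of_pos (by rw [h2 x hx]; norm_num)))
    (Eventually.of_forall fun x => ?_) (Or.inl (by norm_num [z₂₂])) (Or.inl (by norm_num [z₂₂]))
  rcases (f₂_nonneg x).eq_or_lt with hf | hf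
  · rw [singTerm_of_eq_zero hf.symm, posInd_of_eq_zero (u₂₂_of_eq_zero hf.symm)]
    simp
  · have hux : 0 < u₂₂ x := by rw [u₂₂_of_pos hf]; norm_num
    have h : -dz₂₂ x * posInd u₂₂ x = f₂ x / u₂₂ x := by
      rw [posInd_of_pos hux, u₂₂_of_pos hf, dz₂₂, f₂]
      rcases f₂_pos_iff.1 hf with hx | hx
      · rw [if_neg (by linarith), if_neg (by linarith), if_neg (by linarith), if_neg (by linarith)]
        ring
      · rw [if_pos hx.le, if_pos hx.le]
        ring
    rw [singTerm_of_pos hux, h]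
    exact ⟨div_nonneg hf.le hux.le, rfl⟩

lemma u₂₃_of_lt {x : ℝ} (h1 : -1 < x) (h2 : x < -1/4) : u₂₃ x = 1/16 :=
  indicator_of_mem (s := Ioo (-1) (-1/4) ∪ Ioo (1/4) 1) (Or.inl ⟨h1, h2⟩) _

lemma u₂₃_of_gt {x : ℝ} (h1 : 1/4 < x) (h2 : x < 1) : u₂₃ x = 1/16 :=
  indicator_of_mem (s := Ioo (-1) (-1/4) ∪ Ioo (1/4) 1) (Or.inr ⟨h1, h2⟩) _

lemma u₂₃_eq_zero {x : ℝ} (h1 : -1/4 ≤ x) (h2 : x ≤ 1/4) : u₂₃ x = 0 :=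
  indicator_of_notMem (by rintro (h | h) <;> linarith [h.1, h.2]) _

theorem isWeakSolutionWith_u₂₃ : IsWeakSolutionWith (-1) 1 1 f₂ u₂₃ z₂₃ := by
  have hp : z₂₃ (1/4) = 1 := by norm_num [z₂₃]
  have hq : z₂₃ (-(1/4)) = -1 := by norm_num [z₂₃]
  have h0 : ∀ x ∈ Icc (-(1/4) : ℝ) (1/4), u₂₃ x = 0 := fun x hx =>
    u₂₃_eq_zero (by linarith [hx.1]) hx.2
  have h1 : ∀ x ∈ Ioo (-1 : ℝ) (-(1/4)), u₂₃ x = 1/16 := fun x hx =>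
    u₂₃_of_lt hx.1 (by linarith [hx.2])
  have h2 : ∀ x ∈ Ioo (1/4 : ℝ) 1, u₂₃ x = 1/16 := fun x hx => u₂₃_of_gt hx.1 hx.2
  refine isWeakSolutionWith_of_isOriented (by norm_num) z₂₃_smooth.isPrimitive z₂₃_smooth.meas
    (fun x hx => abs_z₂₃_le hx) (fun x _ => indicator_nonneg (fun _ _ => by norm_num) _)
    (isOriented_outer (by norm_num) (by norm_num) hp hq h0 h1 h2)
    (isOriented_outer zero_le_one (by norm_num) hp hq (fun x hx => posInd_of_eq_zero (h0 x hx))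
      (fun x hx => posInd_of_pos (by rw [h1 x hx]; norm_num))
      (fun x hx => posInd_of_pos (by rw [h2 x hx]; norm_num)))
    ?_ (Or.inl (by norm_num [z₂₃])) (Or.inl (by norm_num [z₂₃]))
  -- Restriction to `]-1,1[` is needed because `u₂₃`, unlike `f₂`, vanishes outside it.
  filter_upwards [ae_restrict_mem measurableSet_Ioo] with x hx
  by_cases hin : x ∈ Icc (-(1/4) : ℝ) (1/4)
  · rw [singTerm_of_eq_zero (f₂_eq_zero (by linarith [hin.1]) (by linarith [hin.2])),
      posInd_of_eq_zero (h0 x hin)]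
    simp
  · have hout : x < -(1/4) ∨ 1/4 < x := by
      by_contra! h
      exact hin h
    have hu : u₂₃ x = 1/16 := hout.elim (fun h => h1 x ⟨hx.1, h⟩) fun h => h2 x ⟨h, hx.2⟩
    have hux : 0 < u₂₃ x := by rw [hu]; norm_num
    -- For `1/4 < |x| < 1/2` both sides are `0`: the field is constant there, so `u₂₃` may stay
    -- positive where `f₂ = 0`.
    have h : -dz₂₃ x * posInd u₂₃ x = f₂ x / u₂₃ x := by
      rw [posInd_of_pos hux, hu, dz₂₃, f₂]
      rcases hout with h | h
      · have e1 : ¬ 1/2 ≤ x := by linarith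
        have e2 : ¬ 1/4 ≤ x := by linarith
        have e3 : ¬ -1/4 < x := by linarith
        simp only [e1, e2, e3, if_false]
        split_ifs <;> ring
      · have e1 : -1/2 < x := by linarith
        simp only [e1, h.le, if_true]
        split_ifs <;> ring
    rw [singTerm_of_pos hux, h]
    exact ⟨div_nonneg (f₂_nonneg x) hux.le, rfl⟩

lemma different_u₂₁_u₂₂ : Different u₂₁ u₂₂ := by
  refine different_of_ne_on_Ioo (p := 1/2) (q := 1) (by norm_num)
    (Ioo_subset_Ioo_left (by norm_num)) fun x hx => ?_
  rw [u₂₂_of_pos (f₂_pos_iff.2 (Or.inr hx.1)), u₂₁]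
  norm_num

lemma different_u₂₁_u₂₃ : Different u₂₁ u₂₃ := by
  refine different_of_ne_on_Ioo (p := 1/2) (q := 1) (by norm_num)
    (Ioo_subset_Ioo_left (by norm_num)) fun x hx => ?_
  rw [u₂₃_of_gt (by linarith [hx.1]) hx.2, u₂₁]
  norm_num

lemma different_u₂₂_u₂₃ : Different u₂₂ u₂₃ := by
  refine different_of_ne_on_Ioo (p := 1/4) (q := 1/2) (by norm_num)
    (Ioo_subset_Ioo (by norm_num) (by norm_num)) fun x hx => ?_
  rw [u₂₃_of_gt hx.1 (by linarith [hx.2]),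
    u₂₂_of_eq_zero (f₂_eq_zero (by linarith [hx.1]) hx.2.le)]
  norm_num

lemma not_derivCarried_z₂₂ : ¬ DerivCarried (Ioo (-1) 1) z₂₂ u₂₂ := by
  -- The interval is the whole gap `]-1/2, 1/2[`, where `z₂₂` has slope `2`.
  refine not_derivCarried (c := 0) (r := 1/2) (k := 2) (by norm_num) (by norm_num)
    (by norm_num) z₂₂_smooth.isPrimitive (fun x hx => ?_) (fun x hx => ?_) fun x hx => ?_
  · constructor <;> linarith [hx.1, hx.2]
  · rw [dz₂₂, if_neg (by linarith [hx.2]), if_pos (by linarith [hx.1])]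
  · exact u₂₂_of_eq_zero (f₂_eq_zero (by linarith [hx.1]) (by linarith [hx.2]))

end OneLap

end

open OneLap in
theorem mainTheorem7 :
    -- first example
    (OneLap.IsDatum (-1) 1 OneLap.f₁ ∧
      0 < volume {x ∈ Ioo (-1 : ℝ) 1 | OneLap.f₁ x = 0} ∧
      OneLap.IsWeakSolutionWith (-1) 1 1 OneLap.f₁ OneLap.u₁₁ OneLap.z₁₁ ∧
      (∀ u : ℝ → ℝ, (∀ x ∈ Ioo (-1 : ℝ) 1, 0 ≤ u x ∧ u x ≤ 1/2) →
        MonotoneOn u (Ioc (-1) (-1/2)) → (∀ x ∈ Ioo (-1/2 : ℝ) (1/2), u x = 1/2) →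
        AntitoneOn u (Ico (1/2) 1) →
        OneLap.IsWeakSolutionWith (-1) 1 1 OneLap.f₁ u OneLap.z₁₁) ∧
      OneLap.IsWeakSolutionWith (-1) 1 1 OneLap.f₁ OneLap.u₁₂ OneLap.z₁₁ ∧
      OneLap.IsWeakSolutionWith (-1) 1 1 OneLap.f₁ OneLap.u₁₂ OneLap.z₁₂ ∧
      OneLap.Different OneLap.u₁₁ OneLap.u₁₂ ∧
      OneLap.Different OneLap.z₁₁ OneLap.z₁₂ ∧
      OneLap.DerivCarried (Ioo (-1) 1) OneLap.z₁₁ OneLap.u₁₂ ∧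
      ¬ OneLap.DerivCarried (Ioo (-1) 1) OneLap.z₁₂ OneLap.u₁₂) ∧
    -- second example
    (OneLap.IsDatum (-1) 1 OneLap.f₂ ∧
      0 < volume {x ∈ Ioo (-1 : ℝ) 1 | OneLap.f₂ x = 0} ∧
      OneLap.IsWeakSolutionWith (-1) 1 1 OneLap.f₂ OneLap.u₂₁ OneLap.z₂₁ ∧
      OneLap.IsWeakSolutionWith (-1) 1 1 OneLap.f₂ OneLap.u₂₂ OneLap.z₂₂ ∧
      OneLap.IsWeakSolutionWith (-1) 1 1 OneLap.f₂ OneLap.u₂₃ OneLap.z₂₃ ∧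
      OneLap.Different OneLap.u₂₁ OneLap.u₂₂ ∧
      OneLap.Different OneLap.u₂₁ OneLap.u₂₃ ∧
      OneLap.Different OneLap.u₂₂ OneLap.u₂₃ ∧
      (∀ x ∈ Ioo (-1 : ℝ) 1, 0 < OneLap.f₂ x → OneLap.u₂₁ x ≠ OneLap.u₂₂ x) ∧
      ¬ OneLap.DerivCarried (Ioo (-1) 1) OneLap.z₂₂ OneLap.u₂₂) ∧
    -- uniqueness of weak solutions fails for both data
    (¬ ∀ u v : ℝ → ℝ, OneLap.IsWeakSolution (-1) 1 1 OneLap.f₁ u →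
      OneLap.IsWeakSolution (-1) 1 1 OneLap.f₁ v → u =ᵐ[volume.restrict (Ioo (-1) 1)] v) ∧
    (¬ ∀ u v : ℝ → ℝ, OneLap.IsWeakSolution (-1) 1 1 OneLap.f₂ u →
      OneLap.IsWeakSolution (-1) 1 1 OneLap.f₂ v → u =ᵐ[volume.restrict (Ioo (-1) 1)] v) := by
  refine ⟨⟨isDatum_f₁, volume_zeros_pos (p := 1/2) (q := 1) (by norm_num)
      (Ioo_subset_Ioo_left (by norm_num)) fun x hx => f₁_of_notMem fun h => h.2.not_gt hx.1,
      isWeakSolutionWith_u₁₁, fun u hu hp hpq hq => isWeakSolutionWith_z₁₁ hu hp hpq hq,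
      isWeakSolutionWith_u₁₂, isWeakSolutionWith_u₁₂_z₁₂, different_u₁₁_u₁₂, different_z₁₁_z₁₂,
      derivCarried_z₁₁, not_derivCarried_z₁₂⟩,
    ⟨isDatum_f₂, volume_zeros_pos (p := -1/2) (q := 1/2) (by norm_num)
      (Ioo_subset_Ioo (by norm_num) (by norm_num)) fun x hx => f₂_eq_zero hx.1.le hx.2.le,
      isWeakSolutionWith_u₂₁, isWeakSolutionWith_u₂₂, isWeakSolutionWith_u₂₃, different_u₂₁_u₂₂,
      different_u₂₁_u₂₃, different_u₂₂_u₂₃, fun x _ hx => ?_, not_derivCarried_z₂₂⟩,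
    fun h => different_u₁₁_u₁₂ (h _ _ ⟨_, isWeakSolutionWith_u₁₁⟩ ⟨_, isWeakSolutionWith_u₁₂⟩),
    fun h => different_u₂₁_u₂₂ (h _ _ ⟨_, isWeakSolutionWith_u₂₁⟩ ⟨_, isWeakSolutionWith_u₂₂⟩)⟩
  rw [u₂₂_of_pos hx, u₂₁]
  norm_num
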